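/- **Setting.** Let $K,n,m,b\ge 1$ be integers (we write $n=n_K$ for the common number of nodes of every layer). Let $\sigma:\mathbb R\to\mathbb R$ be twice differentiable with $\|\sigma\|_\infty\le 1$, $\|\sigma'\|_\infty<\infty$, $\|\sigma''\|_\infty<\infty$, and let $(y_i,z_i)\in\mathbb R^n\times\mathbb R^n$, $1\le i\le m$, satisfy $\|y_i\|_\infty\le1$, $\|z_i\|_\infty\le 1$. Let $W=(\mathbb R^{n\times n})^K$. For $w=(w_1,\dots,w_K)\in W$ and $y\in\mathbb R^n$ put $x^0(w;y)=y$, $x^k_i(w;y)=\sigma\big(\sum_j w_{k,i,j}x^{k-1}_j(w;y)\big)$ for $1\le k\le K$, and $$f_i(w)=\|x^K(w;y_i)-z_i\|_2^2,\qquad f(w)=\frac1m\sum_{i=1}^m f_i(w).$$ **Local norms.** Fix $q\in\{2,\infty\}$ and let $\|A\|_q$ be the induced matrix norm (spectral norm for $q=2$, largest absolute row sum for $q=\infty$). Let $(c_q,d_{q,1},d_{q,2})=(\sqrt n,4\sqrt n,2)$ for $q=2$ and $(1,4n,2n)$ for $q=\infty$. Let $r_k(\zeta_1,\dots,\zeta_k)=\|\sigma'\|_\infty^k\prod_{i\le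 k}\zeta_i$, $v_0=0$, $$v_k(\zeta_1,\dots,\zeta_k)=\|\sigma''\|_\infty \zeta_k^2\|\sigma'\|_\infty^{2(k-1)}\prod_{i<k}\zeta_i^2+\|\sigma'\|_\infty \zeta_k v_{k-1}(\zeta_1,\dots,\zeta_{k-1}),$$ $s_k=d_{q,2}c_q^2\|\sigma'\|_\infty^2r_k^2+d_{q,1}c_q^2\|\sigma'\|_\infty^2v_k+d_{q,1}c_q^2\|\sigma''\|_\infty r_k$, and $p_i(w)=\sqrt{s_{K-i}(\|w_{i+1}\|_q,\dots,\|w_K\|_q)+1}$. Give $W$ the norms $\|\delta w\|_w=\sum_{i=1}^Kp_i(w)\|\delta w_i\|_q$, and linear functionals the dual norms $\|\ell\|_w=\sup_{\|u\|_w=1}\ell(u)$. For a functional $\ell$ on $\mathbb R^{n\times n}$, identified with its matrix of coefficients, $\|\ell\|_q$ denotes the dual norm $\sup_{\|A\|_q=1}\sum_{a,c}\ell_{a,c}A_{a,c}$. **Duality maps.** For a functional $\ell$ on $\mathbb R^{n\times n}$ with singular value decomposition $\ell=\sum_i s_iu_iv_i^T$ let $\rho_2(\ell)=\|\ell\|_2\sum_{s_i\ne0}u_iv_i^T$;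 let $\rho_\infty(\ell)=\|\ell\|_\infty M$, where $M_{i,j}=\operatorname{sgn}(\ell_{i,j})$ if $j=\arg\max_k|\ell_{i,k}|$ and $M_{i,j}=0$ otherwise. For $\ell=(\ell_1,\dots,\ell_K)$ a functional on $W$ let $\rho_w(\ell)\in W$ have the component $p_{i^*}(w)^{-2}\rho_q(\ell_{i^*})$ in layer $i^*=\arg\max_i\|\ell_i\|_q/p_i(w)$ and zero in all other layers. Ties in the $\arg\max$'s are broken by arbitrary fixed rules. **Algorithm.** Let $B(1),B(2),\dots$ be independent and uniformly distributed on $\{1,\dots,m\}^b$, let $\alpha\in(0,1)$, let $w(1)\in W$ be given, and for $t\ge1$ let $$w(t+1)=w(t)-2\alpha\,\rho_{w(t)}(g(t)),\qquad g(t)=\frac1b\sum_{k=1}^{b}\frac{\partial f_{B(t)_k}}{\partial w}(w(t)).$$ **Proposition.** Let $\sigma^2:=\frac{32}{b}n^5K^2$ (a number, unrelated to the activation function), let $\gamma\ge\frac{13}{(1-\alpha)^2}\sigma^2$, and let $$\tau=\inf\Big\{t\ge1:\ \big\|\tfrac{\partial f}{\partial w}(w(t))\big\|_{w(t)}^2\le\gamma\Big\}\in\mathbb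 N\cup\{\infty\}.$$ Then $$\mathbb E[\tau]<\frac{4f(w(1))+\gamma}{4\alpha(1-\alpha)\left[\gamma-\frac{13}{(1-\alpha)^2}\sigma^2\right]},$$ where for $\gamma=\frac{13}{(1-\alpha)^2}\sigma^2$ the right-hand side is read as $+\infty$ (so that the claim is then $\mathbb E[\tau]<\infty$). -/

import Mathlib

open MeasureTheory ProbabilityTheory
open scoped ENNReal

noncomputable section

namespace LayerNet

/-- The choice `q ∈ {2, ∞}`. -/
inductive NormChoice
  | two
  | infty

/-- Weights `w = (w_1, …, w_K)`, each `w_k` a real `n × n` matrix; layer `k` (counted from 1) has index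
`k - 1 : Fin K`. Written as an iterated product, so that it carries a (fixed, auxiliary) norm; this
norm enters only through the notions of derivative and of continuous functional, which do not depend
on it. -/
abbrev Params (K n : ℕ) : Type := Fin K → Fin n → Fin n → ℝ

/-- The space `𝓛(W, ℝ)` of linear functionals on the parameter space. -/
abbrev Functional (K n : ℕ) : Type := Params K n →L[ℝ] ℝ

/-! ### The network and the objective -/

/-- States `x^k(w; y)`, `k = 0, …, K`: `x^0 = y` and `x^k_i = σ (∑ j, w_{k,i,j} x^{k-1}_j)`. -/
def layerState {K n : ℕ} (σ : ℝ → ℝ) (w : Params K n) (y : Fin n → ℝ) :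
    Fin (K + 1) → Fin n → ℝ :=
  Fin.induction (motive := fun _ => Fin n → ℝ) y
    (fun (k : Fin K) (x : Fin n → ℝ) => fun i => σ (∑ j, w k i j * x j))

/-- Output `x^K(w; y)`. -/
def netOutput {K n : ℕ} (σ : ℝ → ℝ) (w : Params K n) (y : Fin n → ℝ) : Fin n → ℝ :=
  layerState σ w y (Fin.last K)

/-- Loss of one input/target pair: `‖x^K(w; y) - z‖_2 ^ 2`. -/
def sampleLoss {K n : ℕ} (σ : ℝ → ℝ) (y z : Fin n → ℝ) (w : Params K n) : ℝ :=
  ∑ i, (netOutput σ w y i - z i) ^ 2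

/-- Empirical error `f(w) = (1 / m) ∑ i, f_i(w)`. -/
def empError {K n m : ℕ} (σ : ℝ → ℝ) (y z : Fin m → Fin n → ℝ) (w : Params K n) : ℝ :=
  (1 / (m : ℝ)) * ∑ i, sampleLoss σ (y i) (z i) w

/-- Mini-batch derivative `(1 / b) ∑_{j ∈ B} ∂f_j/∂w (w)` for `B ∈ {1, …, m} ^ b`. -/
def batchGrad {K n m b : ℕ} (σ : ℝ → ℝ) (y z : Fin m → Fin n → ℝ) (w : Params K n)
    (B : Fin b → Fin m) : Functional K n :=
  (1 / (b : ℝ)) • ∑ k, fderiv ℝ (sampleLoss σ (y (B k)) (z (B k))) w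

/-! ### The polynomials `p_i` -/

/-- `‖h‖_∞`, for a bounded function on the line. -/
def supNorm (h : ℝ → ℝ) : ℝ := ⨆ u, |h u|

/-- Matrix norm induced by `‖·‖_q`: spectral norm, respectively largest absolute row sum. -/
def matNorm {n : ℕ} : NormChoice → (Fin n → Fin n → ℝ) → ℝ
  | .two, A => ‖Matrix.toEuclideanCLM (n := Fin n) (𝕜 := ℝ) (Matrix.of A)‖
  | .infty, A => ⨆ i, ∑ j, |A i j|

/-- `c_q` -/
def cConst (n : ℕ) : NormChoice → ℝ
  | .two => √n
  | .infty => 1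

/-- `d_{q,1}` -/
def dConst₁ (n : ℕ) : NormChoice → ℝ
  | .two => 4 * √n
  | .infty => 4 * n

/-- `d_{q,2}` -/
def dConst₂ (n : ℕ) : NormChoice → ℝ
  | .two => 2
  | .infty => 2 * n

/-- `r_k(z_1, …, z_k) = ‖σ'‖_∞ ^ k ∏ z_i` -/
def rPoly (σ : ℝ → ℝ) {k : ℕ} (z : Fin k → ℝ) : ℝ :=
  supNorm (deriv σ) ^ k * ∏ i, z i

/-- `v_0 = 0` and
`v_k(z_1, …, z_k) = ‖σ''‖_∞ z_k² ‖σ'‖_∞^{2(k-1)} ∏_{i<k} z_i² + ‖σ'‖_∞ z_k v_{k-1}(z_1, …, z_{k-1})`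
(which for `k = 1` reads `‖σ''‖_∞ z_1²`). -/
def vPoly (σ : ℝ → ℝ) : (k : ℕ) → (Fin k → ℝ) → ℝ
  | 0, _ => 0
  | k + 1, z =>
    supNorm (deriv (deriv σ)) * z (Fin.last k) ^ 2 * supNorm (deriv σ) ^ (2 * k) *
        ∏ i, (Fin.init z : Fin k → ℝ) i ^ 2 +
      supNorm (deriv σ) * z (Fin.last k) * vPoly σ k (Fin.init z)

/-- `s_k(z_1, …, z_k)` -/
def sPoly (q : NormChoice) (n : ℕ) (σ : ℝ → ℝ) {k : ℕ} (z : Fin k → ℝ) : ℝ :=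
  dConst₂ n q * cConst n q ^ 2 * supNorm (deriv σ) ^ 2 * rPoly σ z ^ 2 +
    dConst₁ n q * cConst n q ^ 2 * supNorm (deriv σ) ^ 2 * vPoly σ k z +
    dConst₁ n q * cConst n q ^ 2 * supNorm (deriv (deriv σ)) * rPoly σ z

/-- `p_i(w) = √(s(‖w_{i+1}‖_q, …, ‖w_K‖_q) + 1)`, with one argument for each layer after `i`. -/
def pPoly {K n : ℕ} (q : NormChoice) (σ : ℝ → ℝ) (w : Params K n) (i : Fin K) : ℝ :=
  √(sPoly q n σ (fun j : Fin (K - 1 - i) => matNorm q (w ⟨i + 1 + j, by omega⟩)) + 1)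

/-! ### Finsler structure and dual norms -/

/-- `‖(δw_1, …, δw_K)‖_w = ∑ i, p_i(w) ‖δw_i‖_q` -/
def finslerNorm {K n : ℕ} (q : NormChoice) (σ : ℝ → ℝ) (w δ : Params K n) : ℝ :=
  ∑ i, pPoly q σ w i * matNorm q (δ i)

/-- The dual norm at `w`: `‖ℓ‖_w = sup {ℓ(u) : ‖u‖_w = 1}`. -/
def dualNormAt {K n : ℕ} (q : NormChoice) (σ : ℝ → ℝ) (w : Params K n) (ℓ : Functional K n) : ℝ :=
  sSup {x | ∃ u : Params K n, finslerNorm q σ w u = 1 ∧ x = ℓ u}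

/-- The matrix of the component `ℓ_i` of a functional `ℓ = (ℓ_1, …, ℓ_K)`, which is
`ℓ_i(A) = ∑ a c, (ℓ_i)_{a,c} A_{a,c}`. -/
def component {K n : ℕ} (ℓ : Functional K n) (i : Fin K) : Fin n → Fin n → ℝ :=
  fun a c => ℓ (Pi.single i (Pi.single a (Pi.single c 1)))

/-- The dual of the matrix norm `‖·‖_q`, for functionals on one layer given by their matrices. -/
def matDualNorm {n : ℕ} (q : NormChoice) (L : Fin n → Fin n → ℝ) : ℝ :=
  sSup {x | ∃ A : Fin n → Fin n → ℝ, matNorm q A = 1 ∧ x = ∑ a, ∑ c, L a c * A a c}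

/-! ### Duality maps -/

/-- A choice of `argmax` for vectors indexed by `ι`, with an arbitrary tie-breaking rule. -/
structure ArgmaxRule (ι : Type) where
  toFun : (ι → ℝ) → ι
  le_toFun : ∀ (v : ι → ℝ) (i : ι), v i ≤ v (toFun v)

lemma gram_isHermitian {n : ℕ} (L : Matrix (Fin n) (Fin n) ℝ) :
    (L.conjTranspose * L).IsHermitian :=
  Matrix.isHermitian_conjTranspose_mul_self L

/-- Right singular vectors of `L`: an orthonormal eigenbasis of `Lᵀ L`. -/
def rightSingular {n : ℕ} (L : Matrix (Fin n) (Fin n) ℝ) (i : Fin n) : Fin n → ℝ :=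
  fun a => (gram_isHermitian L).eigenvectorBasis i a

/-- Singular values of `L`: square roots of the eigenvalues of `Lᵀ L`. -/
def singularValue {n : ℕ} (L : Matrix (Fin n) (Fin n) ℝ) (i : Fin n) : ℝ :=
  √((gram_isHermitian L).eigenvalues i)

/-- Left singular vectors `u_i = L v_i / σ_i` of `L`, used only where `σ_i ≠ 0`. -/
def leftSingular {n : ℕ} (L : Matrix (Fin n) (Fin n) ℝ) (i : Fin n) : Fin n → ℝ :=
  (singularValue L i)⁻¹ • L.mulVec (rightSingular L i)

/-- Duality map `ρ_q` on matrices. For `q = 2`: `‖L‖_2 ∑ u_i v_iᵀ`, over the nonzero singular values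
of `L`. For `q = ∞`: `‖L‖_∞` times the matrix with the sign of a largest entry in each row.
Here `‖L‖_q` is the dual norm. -/
def matDuality {n : ℕ} (rowMax : ArgmaxRule (Fin n)) :
    NormChoice → (Fin n → Fin n → ℝ) → Fin n → Fin n → ℝ
  | .two, L => fun a c => matDualNorm .two L *
      ∑ i with singularValue (Matrix.of L) i ≠ 0,
        leftSingular (Matrix.of L) i a * rightSingular (Matrix.of L) i c
  | .infty, L => fun a c => matDualNorm .infty L *
      if c = rowMax.toFun (fun k => |L a k|) then Real.sign (L a c) else 0

/-- Duality structure `ρ_w(ℓ) = (0, …, ρ_q(ℓ_{i*}) / p_{i*}(w)², …, 0)` with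
`i* = argmax_i ‖ℓ_i‖_q / p_i(w)`. -/
def dualityMap {K n : ℕ} (q : NormChoice) (σ : ℝ → ℝ) (rowMax : ArgmaxRule (Fin n))
    (layerMax : ArgmaxRule (Fin K)) (w : Params K n) (ℓ : Functional K n) : Params K n :=
  let s := layerMax.toFun (fun i => 1 / pPoly q σ w i * matDualNorm q (component ℓ i))
  Pi.single s ((1 / pPoly q σ w s ^ 2) • matDuality rowMax q (component ℓ s))

/-! ### Stochastic duality structure gradient descent -/

/-- `w(1), w(2), …` is a run of mini-batch duality structure gradient descent with step size `ε` and
initial point `w₁`: the batches `B(1), B(2), …` are independent and uniformly distributed on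
`{1, …, m} ^ b`, and `w(t+1) = w(t) - ε ρ_{w(t)}(g(t))` with
`g(t) = (1 / b) ∑_{j ∈ B(t)} ∂f_j/∂w (w(t))`. The values `B 0` and `w 0` are not used. -/
structure IsStochasticRun {K n m b : ℕ} (q : NormChoice) (σ : ℝ → ℝ) (y z : Fin m → Fin n → ℝ)
    (rowMax : ArgmaxRule (Fin n)) (layerMax : ArgmaxRule (Fin K)) (ε : ℝ) (w₁ : Params K n)
    {Ω : Type*} [MeasurableSpace Ω] (P : Measure Ω)
    (B : ℕ → Ω → Fin b → Fin m) (w : ℕ → Ω → Params K n) : Prop where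
  measurable_batch : ∀ t, 1 ≤ t → Measurable (B t)
  uniform_batch : ∀ t, 1 ≤ t → ∀ c : Fin b → Fin m, P {ω | B t ω = c} = ((m : ℝ≥0∞) ^ b)⁻¹
  indep_batch : iIndepFun (fun t : ℕ => B (t + 1)) P
  init : ∀ ω, w 1 ω = w₁
  step : ∀ t, 1 ≤ t → ∀ ω, w (t + 1) ω =
    w t ω - ε • dualityMap q σ rowMax layerMax (w t ω) (batchGrad σ y z (w t ω) (B t ω))

/-- `τ = inf {t ≥ 1 : ‖∂f/∂w (w(t))‖_{w(t)}² ≤ γ}`, which is `∞` if there is no such `t`. -/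
def hittingTime {K n m : ℕ} (q : NormChoice) (σ : ℝ → ℝ) (y z : Fin m → Fin n → ℝ) (γ : ℝ)
    {Ω : Type*} (w : ℕ → Ω → Params K n) (ω : Ω) : ℕ∞ :=
  sInf {T : ℕ∞ | ∃ t : ℕ, T = t ∧ 1 ≤ t ∧
    dualNormAt q σ (w t ω) (fderiv ℝ (empError σ y z) (w t ω)) ^ 2 ≤ γ}

end LayerNet

end

namespace LayerNet

/-! Each step of the algorithm moves a single layer, so only the behaviour of `f` along one layer
matters. If layer `i` moves along a line, the states before it stand still, the state entering it
has entries at most 1, and the later layers propagate velocity and acceleration with factors that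
depend only on their own weights. Hence the second derivative of `f` in direction `A` is at most
`(p_i(w) ‖A‖_q)²` along the entire line (`sampleLoss_line`). As `p_i` does not involve `w_i`, this
gives a quadratic upper bound for steps of any size (`empError_step`).

The duality map is a steepest descent direction: `ρ_q(ℓ)` has norm at most `‖ℓ‖_q` and pairs with
`ℓ` to `‖ℓ‖_q²`. If the batch derivative differs from the true one by an error of dual norm at most
`D`, one step lowers `f` by at least `α(1-α)(‖∂f‖_w² - 5D²/(1-α)²)` (`descent_step`). The error is
controlled by a Euclidean norm, where the variance of a sample mean can be computed coordinate by
coordinate; the mean of `D²` is then at most `v = 8n³K/b` (`sum_noiseSq_le`).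

Thus, as long as `‖∂f‖_w² > γ`, the expected value of `f` drops by at least `κ = α(1-α)(γ -
5v/(1-α)²)` per step. Since `f ≥ 0`, telescoping over the survival events gives `E[τ] ≤ 1 +
f(w(1))/κ` (`mul_tsum_lintegral_le`, `hittingTime_le_tsum`). Because `v ≤ σ²` and `5 < 13`, `κ`
stays positive even for the smallest admissible `γ`, and the claimed bound follows with room to
spare. -/

/-- The vector norm `‖·‖_q`. -/
noncomputable def vecNorm {n : ℕ} : NormChoice → (Fin n → ℝ) → ℝ
  | .two, x => ‖WithLp.toLp 2 x‖
  | .infty, x => ‖x‖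

/-! ### Vector norms, induced matrix norms and comparison with the Frobenius norm. -/

section Norms

variable {n : ℕ} (q : NormChoice)

lemma vecNorm_nonneg (x : Fin n → ℝ) : 0 ≤ vecNorm q x := by
  cases q <;> exact norm_nonneg _

lemma vecNorm_zero : vecNorm q (0 : Fin n → ℝ) = 0 := by
  cases q <;> simp [vecNorm]

lemma vecNorm_add_le (x y : Fin n → ℝ) : vecNorm q (x + y) ≤ vecNorm q x + vecNorm q y := by
  cases q
  · simpa [vecNorm] using norm_add_le (WithLp.toLp 2 x) (WithLp.toLp 2 y)
  · exact norm_add_le x y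

lemma vecNorm_two_sq (x : Fin n → ℝ) : vecNorm .two x ^ 2 = ∑ i, x i ^ 2 := by
  simp [vecNorm, EuclideanSpace.norm_sq_eq]

lemma abs_le_vecNorm (x : Fin n → ℝ) (i : Fin n) : |x i| ≤ vecNorm q x := by
  cases q
  · refine abs_le_of_sq_le_sq ?_ (vecNorm_nonneg _ _)
    rw [vecNorm_two_sq]
    exact Finset.single_le_sum (f := fun i => x i ^ 2) (fun _ _ => sq_nonneg _) (Finset.mem_univ i)
  · exact norm_le_pi_norm x i

lemma vecNorm_mul_le {M : ℝ} (hM : 0 ≤ M) (a x : Fin n → ℝ) (ha : ∀ i, |a i| ≤ M) :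
    vecNorm q (fun i => a i * x i) ≤ M * vecNorm q x := by
  cases q
  · refine le_of_sq_le_sq ?_ (mul_nonneg hM (vecNorm_nonneg _ _))
    rw [mul_pow, vecNorm_two_sq, vecNorm_two_sq, Finset.mul_sum]
    refine Finset.sum_le_sum fun i _ => ?_
    rw [mul_pow]
    exact mul_le_mul_of_nonneg_right (sq_le_sq' (abs_le.mp (ha i)).1 (abs_le.mp (ha i)).2)
      (sq_nonneg _)
  · refine (pi_norm_le_iff_of_nonneg (mul_nonneg hM (vecNorm_nonneg _ _))).2 fun i => ?_
    rw [norm_mul]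
    exact mul_le_mul (ha i) (norm_le_pi_norm x i) (norm_nonneg _) hM

lemma vecNorm_sq_le (x : Fin n → ℝ) : vecNorm q (fun i => x i ^ 2) ≤ vecNorm q x ^ 2 := by
  have h := vecNorm_mul_le q (vecNorm_nonneg q x) x x (abs_le_vecNorm q x)
  simpa only [← sq] using h

lemma cConst_nonneg : 0 ≤ cConst n q := by
  cases q <;> simp [cConst]

lemma vecNorm_le_cConst (x : Fin n → ℝ) (hx : ∀ i, |x i| ≤ 1) : vecNorm q x ≤ cConst n q := by
  cases q
  · refine le_of_sq_le_sq ?_ (cConst_nonneg _)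
    rw [vecNorm_two_sq, cConst, Real.sq_sqrt (Nat.cast_nonneg n)]
    calc ∑ i, x i ^ 2 ≤ ∑ _i : Fin n, (1 : ℝ) :=
          Finset.sum_le_sum fun i _ => (sq_le_one_iff_abs_le_one _).2 (hx i)
      _ = n := by simp
  · exact (pi_norm_le_iff_of_nonneg zero_le_one).2 hx

lemma matNorm_nonneg (A : Fin n → Fin n → ℝ) : 0 ≤ matNorm q A := by
  cases q
  · exact norm_nonneg _
  · exact Real.iSup_nonneg fun i => Finset.sum_nonneg fun j _ => abs_nonneg _

lemma row_sum_le_matNorm (A : Fin n → Fin n → ℝ) (i : Fin n) :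
    ∑ j, |A i j| ≤ matNorm .infty A :=
  le_ciSup (f := fun i => ∑ j, |A i j|) (Set.finite_range _).bddAbove i

lemma matNorm_smul (c : ℝ) (A : Fin n → Fin n → ℝ) : matNorm q (c • A) = |c| * matNorm q A := by
  cases q
  · have : Matrix.of (c • A) = c • Matrix.of A := rfl
    simp only [matNorm]
    rw [this, map_smul, norm_smul, Real.norm_eq_abs]
  · simp only [matNorm, Pi.smul_apply, smul_eq_mul, abs_mul, ← Finset.mul_sum]
    exact (Real.mul_iSup_of_nonneg (abs_nonneg c) _).symm

lemma vecNorm_mulVec_le (A : Fin n → Fin n → ℝ) (x : Fin n → ℝ) :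
    vecNorm q (fun i => ∑ j, A i j * x j) ≤ matNorm q A * vecNorm q x := by
  cases q
  · exact (Matrix.toEuclideanCLM (n := Fin n) (𝕜 := ℝ) (Matrix.of A)).le_opNorm (WithLp.toLp 2 x)
  · refine (pi_norm_le_iff_of_nonneg
      (mul_nonneg (matNorm_nonneg _ _) (vecNorm_nonneg _ _))).2 fun i => ?_
    refine (Finset.abs_sum_le_sum_abs _ _).trans ?_
    refine le_trans ?_
      (mul_le_mul_of_nonneg_right (row_sum_le_matNorm A i) (vecNorm_nonneg _ _))
    rw [Finset.sum_mul]
    refine Finset.sum_le_sum fun j _ => ?_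
    rw [abs_mul]
    exact mul_le_mul_of_nonneg_left (abs_le_vecNorm .infty x j) (abs_nonneg _)

lemma matNorm_two_le {A : Fin n → Fin n → ℝ} {M : ℝ} (hM : 0 ≤ M)
    (h : ∀ x : Fin n → ℝ, vecNorm .two (fun i => ∑ j, A i j * x j) ≤ M * vecNorm .two x) :
    matNorm .two A ≤ M :=
  ContinuousLinearMap.opNorm_le_bound _ hM fun x => h x.ofLp

lemma matNorm_infty_le {A : Fin n → Fin n → ℝ} {M : ℝ} (hM : 0 ≤ M)
    (h : ∀ i, ∑ j, |A i j| ≤ M) : matNorm .infty A ≤ M :=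
  Real.iSup_le h hM

/-- The Frobenius norm is at most `√n` times the norm induced by `‖·‖_q`. -/
lemma sum_sq_le_matNorm_sq (A : Fin n → Fin n → ℝ) :
    ∑ a, ∑ c, A a c ^ 2 ≤ n * matNorm q A ^ 2 := by
  cases q
  · rw [Finset.sum_comm]
    calc ∑ c, ∑ a, A a c ^ 2 ≤ ∑ _c : Fin n, matNorm .two A ^ 2 := by
          refine Finset.sum_le_sum fun c _ => ?_
          have h := vecNorm_mulVec_le .two A (Pi.single c 1)
          have h1 : vecNorm .two (Pi.single c 1 : Fin n → ℝ) = 1 := by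
            simp [vecNorm]
          rw [h1, mul_one] at h
          have h2 := pow_le_pow_left₀ (vecNorm_nonneg _ _) h 2
          rw [vecNorm_two_sq] at h2
          simpa [Pi.single_apply] using h2
      _ = n * matNorm .two A ^ 2 := by simp
  · calc ∑ a, ∑ c, A a c ^ 2 ≤ ∑ _a : Fin n, matNorm .infty A ^ 2 := by
          refine Finset.sum_le_sum fun a _ => ?_
          refine le_trans ?_ (pow_le_pow_left₀ (Finset.sum_nonneg fun j _ => abs_nonneg _)
            (row_sum_le_matNorm A a) 2)
          simpa using Finset.sum_sq_le_sq_sum_of_nonneg (s := Finset.univ)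
            (f := fun c => |A a c|) fun i _ => abs_nonneg _
      _ = n * matNorm .infty A ^ 2 := by simp

/-- The factor `n` comes from row sums, by Cauchy–Schwarz. The spectral norm is already at most the
Frobenius norm, and `1 ≤ n` merely weakens that bound to a common form. -/
lemma matNorm_sq_le_sum_sq (hn : 1 ≤ n) (A : Fin n → Fin n → ℝ) :
    matNorm q A ^ 2 ≤ n * ∑ a, ∑ c, A a c ^ 2 := by
  have hS : 0 ≤ ∑ a, ∑ c, A a c ^ 2 := by positivity
  have hn' : (1 : ℝ) ≤ n := by exact_mod_cast hn
  rw [← Real.le_sqrt (matNorm_nonneg _ _) (by positivity)]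
  cases q
  · refine matNorm_two_le (Real.sqrt_nonneg _) fun x => ?_
    refine le_of_sq_le_sq ?_ (mul_nonneg (Real.sqrt_nonneg _) (vecNorm_nonneg _ _))
    rw [mul_pow, Real.sq_sqrt (by positivity), vecNorm_two_sq, vecNorm_two_sq]
    calc ∑ a, (∑ c, A a c * x c) ^ 2 ≤ ∑ a, (∑ c, A a c ^ 2) * ∑ c, x c ^ 2 :=
          Finset.sum_le_sum fun a _ => Finset.sum_mul_sq_le_sq_mul_sq _ _ _
      _ = (∑ a, ∑ c, A a c ^ 2) * ∑ c, x c ^ 2 := by rw [Finset.sum_mul]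
      _ ≤ _ := by
        refine mul_le_mul_of_nonneg_right ?_ (by positivity)
        nlinarith
  · refine matNorm_infty_le (Real.sqrt_nonneg _) fun a => ?_
    refine Real.le_sqrt_of_sq_le ?_
    have h := sq_sum_le_card_mul_sum_sq (s := Finset.univ) (f := fun c => |A a c|)
    simp only [sq_abs, Finset.card_univ, Fintype.card_fin] at h
    refine h.trans (mul_le_mul_of_nonneg_left ?_ (by positivity))
    exact Finset.single_le_sum (f := fun a => ∑ c, A a c ^ 2) (fun _ _ => by positivity)
      (Finset.mem_univ a)

end Norms

/-! ### Velocity and acceleration of curves through linear maps and activations. -/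

section Curves

variable {n : ℕ} {q : NormChoice} {σ : ℝ → ℝ}

lemma supNorm_nonneg (h : ℝ → ℝ) : 0 ≤ supNorm h :=
  Real.iSup_nonneg fun _ => abs_nonneg _

lemma abs_le_supNorm {h : ℝ → ℝ} (hb : BddAbove (Set.range fun u => |h u|)) (u : ℝ) :
    |h u| ≤ supNorm h :=
  le_ciSup (f := fun u => |h u|) hb u

/-- A twice differentiable curve with velocity at most `R` and acceleration at most `V`
in `‖·‖_q`. -/
def CurveBounds (q : NormChoice) (X : ℝ → Fin n → ℝ) (R V : ℝ) : Prop :=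
  ∃ X' X'' : ℝ → Fin n → ℝ, (∀ s i, HasDerivAt (fun s => X s i) (X' s i) s) ∧
    (∀ s i, HasDerivAt (fun s => X' s i) (X'' s i) s) ∧
    (∀ s, vecNorm q (X' s) ≤ R) ∧ ∀ s, vecNorm q (X'' s) ≤ V

lemma CurveBounds.mulVec {X : ℝ → Fin n → ℝ} {R V : ℝ} (h : CurveBounds q X R V)
    (A : Fin n → Fin n → ℝ) :
    CurveBounds q (fun s i => ∑ j, A i j * X s j) (matNorm q A * R) (matNorm q A * V) := by
  obtain ⟨X', X'', h1, h2, hR, hV⟩ := h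
  refine ⟨fun s i => ∑ j, A i j * X' s j, fun s i => ∑ j, A i j * X'' s j,
    fun s i => HasDerivAt.fun_sum fun j _ => (h1 s j).const_mul _,
    fun s i => HasDerivAt.fun_sum fun j _ => (h2 s j).const_mul _, fun s => ?_, fun s => ?_⟩
  · exact (vecNorm_mulVec_le q A _).trans (mul_le_mul_of_nonneg_left (hR s) (matNorm_nonneg _ _))
  · exact (vecNorm_mulVec_le q A _).trans (mul_le_mul_of_nonneg_left (hV s) (matNorm_nonneg _ _))

lemma CurveBounds.activation (hσ : Differentiable ℝ σ) (hσ' : Differentiable ℝ (deriv σ))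
    (hb : BddAbove (Set.range fun u => |deriv σ u|))
    (hb' : BddAbove (Set.range fun u => |deriv (deriv σ) u|))
    {X : ℝ → Fin n → ℝ} {R V : ℝ} (h : CurveBounds q X R V) :
    CurveBounds q (fun s i => σ (X s i)) (supNorm (deriv σ) * R)
      (supNorm (deriv (deriv σ)) * R ^ 2 + supNorm (deriv σ) * V) := by
  obtain ⟨X', X'', h1, h2, hR, hV⟩ := h
  refine ⟨fun s i => deriv σ (X s i) * X' s i,
    fun s => (fun i => deriv (deriv σ) (X s i) * X' s i ^ 2) + fun i => deriv σ (X s i) * X'' s i,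
    fun s i => (hσ (X s i)).hasDerivAt.comp s (h1 s i), fun s i => ?_, fun s => ?_, fun s => ?_⟩
  · have := ((hσ' (X s i)).hasDerivAt.comp s (h1 s i)).mul (h2 s i)
    refine this.congr_deriv ?_
    simp only [Pi.add_apply, Function.comp]
    ring
  · exact (vecNorm_mul_le q (supNorm_nonneg _) _ _ fun i => abs_le_supNorm hb _).trans
      (mul_le_mul_of_nonneg_left (hR s) (supNorm_nonneg _))
  · refine (vecNorm_add_le q _ _).trans (add_le_add ?_ ?_)
    · refine (vecNorm_mul_le q (supNorm_nonneg _) _ _ fun i => abs_le_supNorm hb' _).trans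
        (mul_le_mul_of_nonneg_left ?_ (supNorm_nonneg _))
      exact (vecNorm_sq_le q _).trans (pow_le_pow_left₀ (vecNorm_nonneg _ _) (hR s) 2)
    · exact (vecNorm_mul_le q (supNorm_nonneg _) _ _ fun i => abs_le_supNorm hb _).trans
        (mul_le_mul_of_nonneg_left (hV s) (supNorm_nonneg _))

/-- The layer that moves: its preactivation is affine in `s`, hence has no acceleration. The bound
on `x` is what makes earlier weights disappear from all later estimates. -/
lemma CurveBounds.mulVec_line (A D : Fin n → Fin n → ℝ) (x : Fin n → ℝ) (hx : ∀ i, |x i| ≤ 1) :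
    CurveBounds q (fun s i => ∑ j, (A + s • D) i j * x j) (matNorm q D * cConst n q) 0 := by
  refine ⟨fun _ i => ∑ j, D i j * x j, 0, fun s i => ?_, fun s i => hasDerivAt_const _ _,
    fun s => ?_, fun s => (vecNorm_zero q).le⟩
  · refine HasDerivAt.fun_sum fun j _ => HasDerivAt.mul_const ?_ _
    have := ((hasDerivAt_id s).mul_const (D i j)).const_add (A i j)
    simpa using this
  · exact (vecNorm_mulVec_le q D x).trans
      (mul_le_mul_of_nonneg_left (vecNorm_le_cConst q x hx) (matNorm_nonneg _ _))

end Curves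

/-! ### Recursions for `r_k` and `v_k`, in the shape produced by one more layer. -/

section Polynomials

variable {σ : ℝ → ℝ}

lemma rPoly_succ {k : ℕ} (z : Fin (k + 1) → ℝ) :
    rPoly σ z = supNorm (deriv σ) * (z (Fin.last k) * rPoly σ (Fin.init z : Fin k → ℝ)) := by
  simp only [rPoly, Fin.prod_univ_castSucc, Fin.init]
  ring

lemma vPoly_succ {k : ℕ} (z : Fin (k + 1) → ℝ) :
    vPoly σ (k + 1) z = supNorm (deriv (deriv σ)) *
        (z (Fin.last k) * rPoly σ (Fin.init z : Fin k → ℝ)) ^ 2 +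
      supNorm (deriv σ) * (z (Fin.last k) * vPoly σ k (Fin.init z)) := by
  simp only [vPoly, rPoly, Finset.prod_pow]
  ring

lemma rPoly_nonneg {k : ℕ} {z : Fin k → ℝ} (hz : ∀ i, 0 ≤ z i) : 0 ≤ rPoly σ z :=
  mul_nonneg (pow_nonneg (supNorm_nonneg _) _) (Finset.prod_nonneg fun i _ => hz i)

lemma vPoly_nonneg {k : ℕ} {z : Fin k → ℝ} (hz : ∀ i, 0 ≤ z i) : 0 ≤ vPoly σ k z := by
  induction k with
  | zero => exact le_rfl
  | succ k ih =>
    rw [vPoly_succ]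
    have := ih (z := Fin.init z) fun i => hz _
    have h1 := supNorm_nonneg (deriv (deriv σ))
    have h2 := supNorm_nonneg (deriv σ)
    have h3 := hz (Fin.last k)
    positivity

end Polynomials

/-! ### Motion of the network output when one layer moves along a line. -/

section Network

variable {K n : ℕ} {q : NormChoice} {σ : ℝ → ℝ}

lemma layerState_succ (w : Params K n) (y : Fin n → ℝ) (k : Fin K) :
    layerState σ w y k.succ = fun i => σ (∑ j, w k i j * layerState σ w y k.castSucc j) :=
  Fin.induction_succ (motive := fun _ => Fin n → ℝ) _ _ k

lemma abs_layerState_le_one (hσ : ∀ u, |σ u| ≤ 1) (w : Params K n) {y : Fin n → ℝ}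
    (hy : ∀ i, |y i| ≤ 1) (k : Fin (K + 1)) (i : Fin n) : |layerState σ w y k i| ≤ 1 := by
  induction k using Fin.cases with
  | zero => exact hy i
  | succ k => rw [layerState_succ]; exact hσ _

lemma layerState_eq_of_layers_eq (w w' : Params K n) (y : Fin n → ℝ) (k : ℕ) (hk : k < K + 1)
    (h : ∀ i : Fin K, (i : ℕ) < k → w i = w' i) :
    layerState σ w y ⟨k, hk⟩ = layerState σ w' y ⟨k, hk⟩ := by
  induction k with
  | zero => rfl
  | succ k ih =>
    have hk' : k < K := by omega
    have h1 := layerState_succ (σ := σ) w y ⟨k, hk'⟩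
    have h2 := layerState_succ (σ := σ) w' y ⟨k, hk'⟩
    have h3 := ih (by omega) fun i hi => h i (by omega)
    have h4 := h ⟨k, hk'⟩ (Nat.lt_succ_self k)
    simp only [Fin.succ_mk, Fin.castSucc_mk] at h1 h2
    rw [h1, h2, h3, h4]

/-- Norms of the weights of the `k` layers after layer `i`. -/
noncomputable def laterNorms (q : NormChoice) (w : Params K n) (i : Fin K) (k : ℕ)
    (hk : i + 1 + k ≤ K) : Fin k → ℝ :=
  fun j => matNorm q (w ⟨i + 1 + j, by omega⟩)

/-- Induction on the number `k` of layers passed after layer `i`. A layer multiplies the velocity by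
`‖σ'‖ ‖w‖`. It does the same to the acceleration and adds `‖σ''‖` times the squared preactivation
velocity; this added term is the source of `v_k`, while the acceleration created in layer `i` itself
is carried by `r_k`. -/
lemma curveBounds_layerState (hσ : Differentiable ℝ σ) (hσ' : Differentiable ℝ (deriv σ))
    (hσ_bound : ∀ u, |σ u| ≤ 1)
    (hb : BddAbove (Set.range fun u => |deriv σ u|))
    (hb' : BddAbove (Set.range fun u => |deriv (deriv σ) u|))
    (w : Params K n) (i : Fin K) (A : Fin n → Fin n → ℝ) {y : Fin n → ℝ} (hy : ∀ i, |y i| ≤ 1)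
    (k : ℕ) (hk : i + 1 + k ≤ K) :
    CurveBounds q
      (fun s : ℝ => layerState σ (w + s • (Pi.single i A : Params K n)) y ⟨i + 1 + k, by omega⟩)
      (rPoly σ (laterNorms q w i k hk) *
        (supNorm (deriv σ) * (matNorm q A * cConst n q)))
      (vPoly σ k (laterNorms q w i k hk) *
          (supNorm (deriv σ) * (matNorm q A * cConst n q)) ^ 2 +
        rPoly σ (laterNorms q w i k hk) *
          (supNorm (deriv (deriv σ)) * (matNorm q A * cConst n q) ^ 2)) := by
  induction k with
  | zero =>
    have h0 := (CurveBounds.mulVec_line (q := q) (w i) A (layerState σ w y i.castSucc)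
      (abs_layerState_le_one hσ_bound w hy i.castSucc)).activation hσ hσ' hb hb'
    have hX : (fun s : ℝ => layerState σ (w + s • (Pi.single i A : Params K n)) y
        ⟨i + 1 + 0, by omega⟩) =
        fun (s : ℝ) a => σ (∑ j, (w i + s • A) a j * layerState σ w y i.castSucc j) := by
      funext s
      have h1 := layerState_succ (σ := σ) (w + s • (Pi.single i A : Params K n)) y i
      have h2 := layerState_eq_of_layers_eq (σ := σ) (w + s • (Pi.single i A : Params K n)) w y i
        (by omega) fun j hj => by
          have : j ≠ i := fun h => by simp [h] at hj
          simp [this]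
      refine h1.trans ?_
      funext a
      have h3 : layerState σ (w + s • (Pi.single i A : Params K n)) y i.castSucc =
        layerState σ w y i.castSucc := h2
      rw [h3]
      simp
    rw [hX]
    convert h0 using 1
    · simp [rPoly]
    · simp [rPoly, vPoly]
  | succ k ih =>
    have h0 := ((ih (by omega)).mulVec (w ⟨i + 1 + k, by omega⟩)).activation hσ hσ' hb hb'
    have hX : (fun s : ℝ => layerState σ (w + s • (Pi.single i A : Params K n)) y
        ⟨i + 1 + (k + 1), by omega⟩) =
        fun (s : ℝ) a => σ (∑ j, w ⟨i + 1 + k, by omega⟩ a j *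
          layerState σ (w + s • (Pi.single i A : Params K n)) y ⟨i + 1 + k, by omega⟩ j) := by
      funext s
      refine (layerState_succ (σ := σ) (w + s • (Pi.single i A : Params K n)) y
        ⟨i + 1 + k, by omega⟩).trans ?_
      have : (⟨i + 1 + k, by omega⟩ : Fin K) ≠ i := fun h => by
        have := congrArg Fin.val h
        simp at this
        omega
      simp [this]
    rw [hX, rPoly_succ, vPoly_succ]
    have hl : laterNorms q w i (k + 1) hk (Fin.last k) = matNorm q (w ⟨i + 1 + k, by omega⟩) := rfl
    have hi : (Fin.init (laterNorms q w i (k + 1) hk) : Fin k → ℝ) =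
      laterNorms q w i k (by omega) := rfl
    rw [hl, hi]
    convert h0 using 1 <;> ring

lemma curveBounds_netOutput (hσ : Differentiable ℝ σ) (hσ' : Differentiable ℝ (deriv σ))
    (hσ_bound : ∀ u, |σ u| ≤ 1)
    (hb : BddAbove (Set.range fun u => |deriv σ u|))
    (hb' : BddAbove (Set.range fun u => |deriv (deriv σ) u|))
    (w : Params K n) (i : Fin K) (A : Fin n → Fin n → ℝ) {y : Fin n → ℝ}
    (hy : ∀ i, |y i| ≤ 1) :
    CurveBounds q (fun s : ℝ => netOutput σ (w + s • (Pi.single i A : Params K n)) y)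
      (rPoly σ (laterNorms q w i (K - 1 - i) (by omega)) *
        (supNorm (deriv σ) * (matNorm q A * cConst n q)))
      (vPoly σ (K - 1 - i) (laterNorms q w i (K - 1 - i) (by omega)) *
          (supNorm (deriv σ) * (matNorm q A * cConst n q)) ^ 2 +
        rPoly σ (laterNorms q w i (K - 1 - i) (by omega)) *
          (supNorm (deriv (deriv σ)) * (matNorm q A * cConst n q) ^ 2)) := by
  have h := curveBounds_layerState (q := q) hσ hσ' hσ_bound hb hb' w i A hy (K - 1 - i) (by omega)
  have he : (⟨i + 1 + (K - 1 - i), by omega⟩ : Fin (K + 1)) = Fin.last K := by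
    ext; simp; omega
  rw [he] at h
  exact h

end Network

/-! ### The constants `d_{q,1}`, `d_{q,2}` and a one-sided Taylor bound. -/

section Constants

variable {n : ℕ} (q : NormChoice)

lemma dConst₁_nonneg : 0 ≤ dConst₁ n q := by
  cases q <;> simp [dConst₁]

lemma dConst₂_nonneg : 0 ≤ dConst₂ n q := by
  cases q <;> simp [dConst₂]

/-- Lets the first derivative of the loss, naturally bounded with `dConst₁`, be absorbed into the
`dConst₂` term of `p_i²`. -/
lemma dConst₁_sq : dConst₁ n q ^ 2 = 8 * n * dConst₂ n q := by
  cases q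
  · simp only [dConst₁, dConst₂, mul_pow, Real.sq_sqrt (Nat.cast_nonneg n)]
    ring
  · simp only [dConst₁, dConst₂]
    ring

lemma two_mul_sum_sq_le (x : Fin n → ℝ) : 2 * ∑ i, x i ^ 2 ≤ dConst₂ n q * vecNorm q x ^ 2 := by
  cases q
  · rw [vecNorm_two_sq]; rfl
  · have : ∑ i, x i ^ 2 ≤ ∑ _i : Fin n, vecNorm .infty x ^ 2 :=
      Finset.sum_le_sum fun i _ => sq_le_sq' (abs_le.mp (abs_le_vecNorm _ x i)).1
        (abs_le.mp (abs_le_vecNorm _ x i)).2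
    simp only [Finset.sum_const, Finset.card_univ, Fintype.card_fin, nsmul_eq_mul] at this
    simp only [dConst₂]
    linarith

/-- Here `e` stands for the residual `x^K - z`, whose entries are at most 2 because outputs and
targets lie in `[-1, 1]`. -/
lemma abs_two_mul_sum_mul_le (e x : Fin n → ℝ) (he : ∀ i, |e i| ≤ 2) :
    |2 * ∑ i, e i * x i| ≤ dConst₁ n q * vecNorm q x := by
  have he' : ∑ i, e i ^ 2 ≤ 4 * n := by
    calc ∑ i, e i ^ 2 ≤ ∑ _i : Fin n, (4 : ℝ) := Finset.sum_le_sum fun i _ => by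
          have := abs_le.mp (he i)
          nlinarith
      _ = 4 * n := by simp [mul_comm]
  cases q
  · refine abs_le_of_sq_le_sq ?_ (mul_nonneg (dConst₁_nonneg _) (vecNorm_nonneg _ _))
    rw [mul_pow, mul_pow, vecNorm_two_sq, dConst₁_sq]
    have h1 := Finset.sum_mul_sq_le_sq_mul_sq Finset.univ e x
    have h2 := mul_le_mul_of_nonneg_right he'
      (Finset.sum_nonneg fun i (_ : i ∈ Finset.univ) => sq_nonneg (x i))
    simp only [dConst₂]
    linarith
  · rw [abs_mul, abs_two]
    have : |∑ i, e i * x i| ≤ ∑ _i : Fin n, 2 * vecNorm .infty x := by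
      refine (Finset.abs_sum_le_sum_abs _ _).trans (Finset.sum_le_sum fun i _ => ?_)
      rw [abs_mul]
      exact mul_le_mul (he i) (abs_le_vecNorm _ x i) (abs_nonneg _) zero_le_two
    simp only [Finset.sum_const, Finset.card_univ, Fintype.card_fin, nsmul_eq_mul] at this
    simp only [dConst₁]
    linarith

end Constants

/-- An upper bound on `φ''` suffices, with no continuity of `φ''`: monotonicity is applied twice, to
`φ' - M s` and to `φ - φ'(0) s - M s² / 2`. -/
lemma taylor_two_le {φ φ' φ'' : ℝ → ℝ} {M : ℝ} (h1 : ∀ s, HasDerivAt φ (φ' s) s)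
    (h2 : ∀ s, HasDerivAt φ' (φ'' s) s) (hM : ∀ s, φ'' s ≤ M) :
    φ 1 ≤ φ 0 + φ' 0 + M / 2 := by
  have hg' : ∀ s, HasDerivAt (fun s => φ' s - M * s) (φ'' s - M) s := fun s => by
    simpa using (h2 s).fun_sub ((hasDerivAt_id s).const_mul M)
  have hanti : Antitone fun s => φ' s - M * s :=
    antitone_of_hasDerivAt_nonpos hg' fun s => sub_nonpos.2 (hM s)
  have hg : ∀ s, HasDerivAt (fun s => φ s - φ' 0 * s - M / 2 * s ^ 2) (φ' s - φ' 0 - M * s) s :=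
    fun s => by
      have := (((h1 s).sub ((hasDerivAt_id s).const_mul (φ' 0)))).sub
        (((hasDerivAt_id s).pow 2).const_mul (M / 2))
      refine this.congr_deriv ?_
      simp
      ring
  have hle := antitoneOn_of_deriv_nonpos (convex_Ici (0 : ℝ))
    (f := fun s => φ s - φ' 0 * s - M / 2 * s ^ 2)
    (fun s _ => (hg s).continuousAt.continuousWithinAt)
    (fun s _ => (hg s).differentiableAt.differentiableWithinAt) (fun s hs => by
      rw [(hg s).deriv]
      have : 0 ≤ s := interior_subset hs
      have := hanti this
      simp only [mul_zero, sub_zero] at this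
      linarith) (Set.mem_Ici.2 le_rfl) (Set.mem_Ici.2 zero_le_one) zero_le_one
  simp only [mul_zero, sub_zero] at hle
  linarith

/-! ### Layerwise smoothness and derivative bounds for the loss. -/

section Loss

variable {K n m : ℕ} {q : NormChoice} {σ : ℝ → ℝ}

lemma pPoly_eq (w : Params K n) (i : Fin K) :
    pPoly q σ w i = √(sPoly q n σ (laterNorms q w i (K - 1 - i) (by omega)) + 1) := rfl

lemma laterNorms_nonneg (w : Params K n) (i : Fin K) (k : ℕ) (hk : i + 1 + k ≤ K) (j : Fin k) :
    0 ≤ laterNorms q w i k hk j := matNorm_nonneg _ _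

lemma sPoly_nonneg {k : ℕ} {z : Fin k → ℝ} (hz : ∀ i, 0 ≤ z i) : 0 ≤ sPoly q n σ z := by
  have := rPoly_nonneg (σ := σ) hz
  have := vPoly_nonneg (σ := σ) hz
  have := dConst₁_nonneg (n := n) q
  have := dConst₂_nonneg (n := n) q
  have := supNorm_nonneg (deriv σ)
  have := supNorm_nonneg (deriv (deriv σ))
  unfold sPoly
  positivity

lemma one_le_pPoly (w : Params K n) (i : Fin K) : 1 ≤ pPoly q σ w i := by
  rw [pPoly_eq, Real.one_le_sqrt]
  linarith [sPoly_nonneg (q := q) (n := n) (σ := σ)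
    (laterNorms_nonneg (q := q) w i (K - 1 - i) (by omega))]

lemma pPoly_pos (w : Params K n) (i : Fin K) : 0 < pPoly q σ w i :=
  zero_lt_one.trans_le (one_le_pPoly w i)

lemma pPoly_sq (w : Params K n) (i : Fin K) :
    pPoly q σ w i ^ 2 = sPoly q n σ (laterNorms q w i (K - 1 - i) (by omega)) + 1 := by
  rw [pPoly_eq, Real.sq_sqrt]
  linarith [sPoly_nonneg (q := q) (n := n) (σ := σ)
    (laterNorms_nonneg (q := q) w i (K - 1 - i) (by omega))]

/-- First and second derivatives of the loss when one layer moves along a line. -/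
lemma sampleLoss_line (hσ : Differentiable ℝ σ) (hσ' : Differentiable ℝ (deriv σ))
    (hσ_bound : ∀ u, |σ u| ≤ 1)
    (hb : BddAbove (Set.range fun u => |deriv σ u|))
    (hb' : BddAbove (Set.range fun u => |deriv (deriv σ) u|))
    (w : Params K n) (i : Fin K) (A : Fin n → Fin n → ℝ) {y z : Fin n → ℝ}
    (hy : ∀ i, |y i| ≤ 1) (hz : ∀ i, |z i| ≤ 1) :
    ∃ φ' φ'' : ℝ → ℝ,
      (∀ s, HasDerivAt (fun s : ℝ => sampleLoss σ y z (w + s • (Pi.single i A : Params K n)))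
        (φ' s) s) ∧
      (∀ s, HasDerivAt φ' (φ'' s) s) ∧
      (∀ s, φ' s ^ 2 ≤ 8 * n * (pPoly q σ w i * matNorm q A) ^ 2) ∧
      ∀ s, φ'' s ≤ (pPoly q σ w i * matNorm q A) ^ 2 := by
  obtain ⟨X', X'', h1, h2, hR, hV⟩ :=
    curveBounds_netOutput (q := q) hσ hσ' hσ_bound hb hb' w i A hy
  have hz0 := laterNorms_nonneg (q := q) w i (K - 1 - i) (by omega)
  have hr := rPoly_nonneg (σ := σ) hz0
  have hv := vPoly_nonneg (σ := σ) hz0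
  have hp := pPoly_sq (q := q) (σ := σ) w i
  simp only [sPoly] at hp
  set r := rPoly σ (laterNorms q w i (K - 1 - i) (by omega))
  set v := vPoly σ (K - 1 - i) (laterNorms q w i (K - 1 - i) (by omega))
  set X : ℝ → Fin n → ℝ := fun s => netOutput σ (w + s • (Pi.single i A : Params K n)) y with hXdef
  set S₁ := supNorm (deriv σ)
  set S₂ := supNorm (deriv (deriv σ))
  have hS₁ : 0 ≤ S₁ := supNorm_nonneg _
  have hS₂ : 0 ≤ S₂ := supNorm_nonneg _
  set a := matNorm q A
  have ha : 0 ≤ a := matNorm_nonneg _ _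
  have hc : 0 ≤ cConst n q := cConst_nonneg q
  have hd₁ := dConst₁_nonneg (n := n) q
  have hd₂ := dConst₂_nonneg (n := n) q
  have he : ∀ s j, |X s j - z j| ≤ 2 := fun s j => by
    have h1 : |X s j| ≤ 1 := abs_layerState_le_one hσ_bound _ hy _ _
    have := abs_le.mp h1
    have := abs_le.mp (hz j)
    rw [abs_le]
    constructor <;> linarith
  have hR2 : ∀ s, vecNorm q (X' s) ^ 2 ≤ (r * (S₁ * (a * cConst n q))) ^ 2 := fun s =>
    pow_le_pow_left₀ (vecNorm_nonneg _ _) (hR s) 2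
  refine ⟨fun s => 2 * ∑ j, (X s j - z j) * X' s j,
    fun s => 2 * ∑ j, X' s j ^ 2 + 2 * ∑ j, (X s j - z j) * X'' s j, fun s => ?_, fun s => ?_,
    fun s => ?_, fun s => ?_⟩
  · have h : HasDerivAt (fun s => ∑ j, (X s j - z j) ^ 2)
        (∑ j, ((2 : ℕ) : ℝ) * (X s j - z j) ^ (2 - 1) * X' s j) s :=
      HasDerivAt.fun_sum fun j _ => ((h1 s j).sub_const (z j)).fun_pow 2
    refine h.congr_deriv ?_
    simp only
    rw [Finset.mul_sum]
    refine Finset.sum_congr rfl fun j _ => ?_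
    norm_num
    ring
  · have h : HasDerivAt (fun s => ∑ j, (X s j - z j) * X' s j)
        (∑ j, (X' s j * X' s j + (X s j - z j) * X'' s j)) s :=
      HasDerivAt.fun_sum fun j _ => ((h1 s j).sub_const (z j)).mul (h2 s j)
    refine (h.const_mul 2).congr_deriv ?_
    rw [Finset.sum_add_distrib, mul_add]
    simp only [sq]
  · have h3 := abs_two_mul_sum_mul_le q _ (X' s) (he s)
    have h4 := pow_le_pow_left₀ (abs_nonneg _) h3 2
    rw [sq_abs, mul_pow (dConst₁ n q), dConst₁_sq] at h4
    refine h4.trans ?_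
    calc 8 * n * dConst₂ n q * vecNorm q (X' s) ^ 2
        ≤ 8 * n * dConst₂ n q * (r * (S₁ * (a * cConst n q))) ^ 2 :=
          mul_le_mul_of_nonneg_left (hR2 s) (by positivity)
      _ = 8 * n * ((dConst₂ n q * cConst n q ^ 2 * S₁ ^ 2 * r ^ 2) * a ^ 2) := by ring
      _ ≤ 8 * n * (pPoly q σ w i * a) ^ 2 := by
        rw [mul_pow, hp]
        refine mul_le_mul_of_nonneg_left (mul_le_mul_of_nonneg_right ?_ (sq_nonneg _))
          (by positivity)
        have h5 : 0 ≤ dConst₁ n q * cConst n q ^ 2 * S₁ ^ 2 * v := by positivity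
        have h6 : 0 ≤ dConst₁ n q * cConst n q ^ 2 * S₂ * r := by positivity
        linarith
  · have h3 := (le_abs_self _).trans (abs_two_mul_sum_mul_le q _ (X'' s) (he s))
    have h4 := two_mul_sum_sq_le q (X' s)
    have h5 := mul_le_mul_of_nonneg_left (hR2 s) hd₂
    have h6 := mul_le_mul_of_nonneg_left (hV s) hd₁
    -- The three terms of `s_k` are the squared velocity term and the two acceleration terms; the `+
    -- 1` in `p_i²` leaves the slack `a ^ 2`.
    have h7 : (pPoly q σ w i * a) ^ 2 = dConst₂ n q * (r * (S₁ * (a * cConst n q))) ^ 2 +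
        dConst₁ n q * (v * (S₁ * (a * cConst n q)) ^ 2 + r * (S₂ * (a * cConst n q) ^ 2)) +
        a ^ 2 := by
      rw [mul_pow, hp]
      ring
    have h8 := sq_nonneg a
    simp only
    linarith

lemma differentiable_layerState (hσ : Differentiable ℝ σ) (y : Fin n → ℝ) (k : Fin (K + 1))
    (j : Fin n) : Differentiable ℝ fun w : Params K n => layerState σ w y k j := by
  induction k using Fin.induction generalizing j with
  | zero => exact differentiable_const _
  | succ k ih =>
    simp only [layerState_succ]
    refine hσ.comp (Differentiable.fun_sum fun l _ => Differentiable.mul ?_ (ih l))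
    fun_prop

lemma differentiable_sampleLoss (hσ : Differentiable ℝ σ) (y z : Fin n → ℝ) :
    Differentiable ℝ (sampleLoss σ y z : Params K n → ℝ) := by
  have : Differentiable ℝ fun w : Params K n => ∑ i, (netOutput σ w y i - z i) ^ 2 :=
    Differentiable.fun_sum fun i _ =>
      ((differentiable_layerState hσ y (Fin.last K) i).sub_const _).pow 2
  exact this

lemma hasDerivAt_line {f : Params K n → ℝ} (hf : Differentiable ℝ f) (w D : Params K n) :
    HasDerivAt (fun s : ℝ => f (w + s • D)) (fderiv ℝ f w D) 0 := by
  have hline : HasDerivAt (fun s : ℝ => w + s • D) D 0 := by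
    have h := ((hasDerivAt_id (0 : ℝ)).smul_const D).const_add w
    simpa using h
  have hf0 : HasFDerivAt f (fderiv ℝ f w) (w + (0 : ℝ) • D) := by
    simpa using (hf w).hasFDerivAt
  exact hf0.comp_hasDerivAt (0 : ℝ) hline

lemma sampleLoss_step (hσ : Differentiable ℝ σ) (hσ' : Differentiable ℝ (deriv σ))
    (hσ_bound : ∀ u, |σ u| ≤ 1)
    (hb : BddAbove (Set.range fun u => |deriv σ u|))
    (hb' : BddAbove (Set.range fun u => |deriv (deriv σ) u|))
    (w : Params K n) (i : Fin K) (A : Fin n → Fin n → ℝ) {y z : Fin n → ℝ}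
    (hy : ∀ i, |y i| ≤ 1) (hz : ∀ i, |z i| ≤ 1) :
    sampleLoss σ y z (w + Pi.single i A) ≤ sampleLoss σ y z w +
      fderiv ℝ (sampleLoss σ y z) w (Pi.single i A) + (pPoly q σ w i * matNorm q A) ^ 2 / 2 := by
  obtain ⟨φ', φ'', h1, h2, -, h4⟩ :=
    sampleLoss_line (q := q) hσ hσ' hσ_bound hb hb' w i A hy hz
  have h := taylor_two_le h1 h2 h4
  rw [(h1 0).unique (hasDerivAt_line (differentiable_sampleLoss hσ y z) w (Pi.single i A))] at h
  simpa using h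

lemma fderiv_sampleLoss_sq_le (hσ : Differentiable ℝ σ) (hσ' : Differentiable ℝ (deriv σ))
    (hσ_bound : ∀ u, |σ u| ≤ 1)
    (hb : BddAbove (Set.range fun u => |deriv σ u|))
    (hb' : BddAbove (Set.range fun u => |deriv (deriv σ) u|))
    (w : Params K n) (i : Fin K) (A : Fin n → Fin n → ℝ) {y z : Fin n → ℝ}
    (hy : ∀ i, |y i| ≤ 1) (hz : ∀ i, |z i| ≤ 1) :
    (fderiv ℝ (sampleLoss σ y z) w (Pi.single i A)) ^ 2 ≤
      8 * n * (pPoly q σ w i * matNorm q A) ^ 2 := by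
  obtain ⟨φ', φ'', h1, -, h3, -⟩ :=
    sampleLoss_line (q := q) hσ hσ' hσ_bound hb hb' w i A hy hz
  rw [← (h1 0).unique (hasDerivAt_line (differentiable_sampleLoss hσ y z) w (Pi.single i A))]
  exact h3 0

lemma sampleLoss_nonneg (y z : Fin n → ℝ) (w : Params K n) : 0 ≤ sampleLoss σ y z w :=
  Finset.sum_nonneg fun _ _ => sq_nonneg _

lemma empError_nonneg (y z : Fin m → Fin n → ℝ) (w : Params K n) : 0 ≤ empError σ y z w :=
  mul_nonneg (by positivity) (Finset.sum_nonneg fun _ _ => sampleLoss_nonneg _ _ _)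

lemma fderiv_empError (hσ : Differentiable ℝ σ) (y z : Fin m → Fin n → ℝ) (w : Params K n) :
    fderiv ℝ (empError σ y z) w = (1 / (m : ℝ)) • ∑ j, fderiv ℝ (sampleLoss σ (y j) (z j)) w := by
  have h : HasFDerivAt (fun w : Params K n => ∑ j, sampleLoss σ (y j) (z j) w)
      (∑ j, fderiv ℝ (sampleLoss σ (y j) (z j)) w) w :=
    HasFDerivAt.fun_sum fun j _ => (differentiable_sampleLoss hσ (y j) (z j) w).hasFDerivAt
  exact (h.const_mul (1 / (m : ℝ))).fderiv

lemma empError_step (hm : 1 ≤ m) (hσ : Differentiable ℝ σ) (hσ' : Differentiable ℝ (deriv σ))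
    (hσ_bound : ∀ u, |σ u| ≤ 1)
    (hb : BddAbove (Set.range fun u => |deriv σ u|))
    (hb' : BddAbove (Set.range fun u => |deriv (deriv σ) u|))
    {y z : Fin m → Fin n → ℝ} (hy : ∀ i j, |y i j| ≤ 1) (hz : ∀ i j, |z i j| ≤ 1)
    (w : Params K n) (i : Fin K) (A : Fin n → Fin n → ℝ) :
    empError σ y z (w + Pi.single i A) ≤ empError σ y z w +
      fderiv ℝ (empError σ y z) w (Pi.single i A) + (pPoly q σ w i * matNorm q A) ^ 2 / 2 := by
  have hm0 : (m : ℝ) ≠ 0 := by positivity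
  rw [fderiv_empError hσ]
  have h := Finset.sum_le_sum fun j (_ : j ∈ Finset.univ) =>
    sampleLoss_step (q := q) hσ hσ' hσ_bound hb hb' w i A (hy j) (hz j)
  rw [Finset.sum_add_distrib, Finset.sum_add_distrib, Finset.sum_const, Finset.card_univ,
    Fintype.card_fin, nsmul_eq_mul] at h
  have h' := mul_le_mul_of_nonneg_left h (by positivity : 0 ≤ 1 / (m : ℝ))
  refine h'.trans (le_of_eq ?_)
  simp only [empError, smul_apply, sum_apply, smul_eq_mul]
  field_simp

end Loss

/-! ### Dual matrix norms and the matrices at which they are attained. -/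

section Duality

variable {n : ℕ} {q : NormChoice}

/-- The value at `A` of the functional with matrix `L`. -/
def matPairing (L A : Fin n → Fin n → ℝ) : ℝ := ∑ a, ∑ c, L a c * A a c

lemma matPairing_smul (L A : Fin n → Fin n → ℝ) (t : ℝ) :
    matPairing L (t • A) = t * matPairing L A := by
  simp only [matPairing, Pi.smul_apply, smul_eq_mul, Finset.mul_sum]
  exact Finset.sum_congr rfl fun a _ => Finset.sum_congr rfl fun c _ => by ring

lemma matPairing_neg (L A : Fin n → Fin n → ℝ) : matPairing L (-A) = -matPairing L A := by
  rw [← neg_one_smul ℝ A, matPairing_smul, neg_one_mul]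

lemma matNorm_neg (q : NormChoice) (A : Fin n → Fin n → ℝ) : matNorm q (-A) = matNorm q A := by
  rw [← neg_one_smul ℝ A, matNorm_smul, abs_neg, abs_one, one_mul]

/-- No boundedness is needed, since `sSup` is `0` on empty and on unbounded sets. -/
lemma sSup_nonneg_of_neg_mem {s : Set ℝ} (h : ∀ x ∈ s, -x ∈ s) : 0 ≤ sSup s := by
  rcases s.eq_empty_or_nonempty with rfl | ⟨x, hx⟩
  · simp
  · rcases le_total 0 x with h0 | h0
    · exact Real.sSup_nonneg' ⟨x, hx, h0⟩
    · exact Real.sSup_nonneg' ⟨-x, h x hx, neg_nonneg.2 h0⟩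

lemma matDualNorm_nonneg (q : NormChoice) (L : Fin n → Fin n → ℝ) : 0 ≤ matDualNorm q L := by
  refine sSup_nonneg_of_neg_mem ?_
  rintro x ⟨A, hA, rfl⟩
  exact ⟨-A, (matNorm_neg q A).trans hA, (matPairing_neg L A).symm⟩

lemma matDualNorm_le {L : Fin n → Fin n → ℝ} {M : ℝ} (hM : 0 ≤ M)
    (h : ∀ A, matPairing L A ≤ M * matNorm q A) : matDualNorm q L ≤ M := by
  refine Real.sSup_le ?_ hM
  rintro x ⟨A, hA, rfl⟩
  simpa [hA, matPairing] using h A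

/-- The constant `M` serves only to make the defining set bounded, and to settle matrices of norm
zero, which cannot be normalised. -/
lemma matPairing_le_matDualNorm_mul {L : Fin n → Fin n → ℝ} {M : ℝ}
    (h : ∀ A, matPairing L A ≤ M * matNorm q A) (A : Fin n → Fin n → ℝ) :
    matPairing L A ≤ matDualNorm q L * matNorm q A := by
  rcases (matNorm_nonneg q A).eq_or_lt with h0 | h0
  · have := h A
    rw [← h0, mul_zero] at this ⊢
    exact this
  · rw [← div_le_iff₀ h0]
    refine le_csSup ⟨M, ?_⟩ ⟨(matNorm q A)⁻¹ • A, ?_, ?_⟩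
    · rintro x ⟨A, hA, rfl⟩
      simpa [hA, matPairing] using h A
    · rw [matNorm_smul, abs_inv, abs_of_pos h0, inv_mul_cancel₀ h0.ne']
    · rw [← matPairing, matPairing_smul, div_eq_inv_mul]

/-- A matrix `Q` in the unit ball of `‖·‖_q` at which `L` attains its dual norm. -/
def Norms (q : NormChoice) (L Q : Fin n → Fin n → ℝ) : Prop :=
  matNorm q Q ≤ 1 ∧ ∀ A, matPairing L A ≤ matPairing L Q * matNorm q A

lemma Norms.matPairing_nonneg {L Q : Fin n → Fin n → ℝ} (h : Norms q L Q) :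
    0 ≤ matPairing L Q := by
  have h1 := h.2 (-Q)
  rw [matPairing_neg, matNorm_neg] at h1
  have h3 := h.1
  have h4 := matNorm_nonneg q Q
  by_contra! h5
  nlinarith

lemma Norms.matDualNorm_eq {L Q : Fin n → Fin n → ℝ} (h : Norms q L Q) :
    matDualNorm q L = matPairing L Q := by
  refine le_antisymm (matDualNorm_le h.matPairing_nonneg h.2) ?_
  exact (matPairing_le_matDualNorm_mul h.2 Q).trans
    (mul_le_of_le_one_right (matDualNorm_nonneg q L) h.1)

/-- The dual norm is the sum over rows of the largest absolute entry, by Hölder in each row; one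
signed entry per row attains it. -/
lemma norms_infty (rowMax : ArgmaxRule (Fin n)) (L : Fin n → Fin n → ℝ) :
    Norms .infty L fun a c =>
      if c = rowMax.toFun (fun k => |L a k|) then Real.sign (L a c) else 0 := by
  have hsign : ∀ x : ℝ, |Real.sign x| ≤ 1 := fun x => by
    rcases Real.sign_apply_eq x with h | h | h <;> simp [h]
  refine ⟨matNorm_infty_le zero_le_one fun a => ?_, fun A => ?_⟩
  · simpa [apply_ite abs] using hsign _
  · simp only [matPairing, mul_ite, mul_zero, Finset.sum_ite_eq', Finset.mem_univ, if_true,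
      Finset.sum_mul]
    refine Finset.sum_le_sum fun a _ => ?_
    have habs : ∀ x : ℝ, x * Real.sign x = |x| := fun x => by
      rcases lt_trichotomy x 0 with h | h | h
      · simp [Real.sign_of_neg h, abs_of_neg h]
      · simp [h]
      · simp [Real.sign_of_pos h, abs_of_pos h]
    rw [habs]
    set M := |L a (rowMax.toFun fun k => |L a k|)|
    calc ∑ c, L a c * A a c ≤ ∑ c, M * |A a c| := Finset.sum_le_sum fun c _ => by
          refine (le_abs_self _).trans ?_
          rw [abs_mul]
          exact mul_le_mul_of_nonneg_right (rowMax.le_toFun (fun k => |L a k|) c) (abs_nonneg _)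
      _ = M * ∑ c, |A a c| := by rw [Finset.mul_sum]
      _ ≤ M * matNorm .infty A :=
        mul_le_mul_of_nonneg_left (row_sum_le_matNorm A a) (abs_nonneg _)

/-! ### Singular vectors: the dual of the spectral norm is the nuclear norm. -/

section Singular

variable (L : Matrix (Fin n) (Fin n) ℝ)

lemma sum_rightSingular_mul (x y : Fin n → ℝ) :
    ∑ i, (∑ c, x c * rightSingular L i c) * (∑ c, y c * rightSingular L i c) =
      ∑ c, x c * y c := by
  have h := (gram_isHermitian L).eigenvectorBasis.sum_inner_mul_inner
    (WithLp.toLp 2 x) (WithLp.toLp 2 y)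
  simpa [PiLp.inner_apply, rightSingular, mul_comm] using h

lemma sum_rightSingular_sq (i : Fin n) : ∑ c, rightSingular L i c ^ 2 = 1 := by
  have h := (gram_isHermitian L).eigenvectorBasis.norm_eq_one i
  have h2 : ‖(gram_isHermitian L).eigenvectorBasis i‖ ^ 2 = 1 := by rw [h, one_pow]
  rw [EuclideanSpace.norm_sq_eq] at h2
  simpa [rightSingular] using h2

lemma sum_rightSingular_mul_of_ne {i j : Fin n} (hij : i ≠ j) :
    ∑ c, rightSingular L i c * rightSingular L j c = 0 := by
  have h := (gram_isHermitian L).eigenvectorBasis.inner_eq_zero hij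
  simpa [PiLp.inner_apply, rightSingular, mul_comm] using h

lemma mulVec_rightSingular_dotProduct (i j : Fin n) :
    ∑ a, L.mulVec (rightSingular L i) a * L.mulVec (rightSingular L j) a =
      (gram_isHermitian L).eigenvalues j * ∑ c, rightSingular L i c * rightSingular L j c := by
  have h := (gram_isHermitian L).mulVec_eigenvectorBasis j
  have h1 : (L.conjTranspose * L).mulVec (rightSingular L j) =
      (gram_isHermitian L).eigenvalues j • rightSingular L j := h
  have h2 : (L.mulVec (rightSingular L i)) ⬝ᵥ (L.mulVec (rightSingular L j)) =
      rightSingular L i ⬝ᵥ (L.conjTranspose * L).mulVec (rightSingular L j) := by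
    rw [← Matrix.mulVec_mulVec, Matrix.conjTranspose_eq_transpose_of_trivial,
      Matrix.mulVec_transpose, dotProduct_comm (rightSingular L i), ← Matrix.dotProduct_mulVec,
      dotProduct_comm]
  rw [h1, dotProduct_smul] at h2
  exact h2

lemma eigenvalues_gram_nonneg (i : Fin n) : 0 ≤ (gram_isHermitian L).eigenvalues i :=
  (Matrix.posSemidef_conjTranspose_mul_self L).eigenvalues_nonneg i

lemma sum_mulVec_rightSingular_sq (i : Fin n) :
    ∑ a, L.mulVec (rightSingular L i) a ^ 2 = singularValue L i ^ 2 := by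
  have h := mulVec_rightSingular_dotProduct L i i
  simp only [← sq, sum_rightSingular_sq, mul_one] at h
  rw [h, singularValue, Real.sq_sqrt (eigenvalues_gram_nonneg L i)]

/-- Only `i` needs a nonzero singular value: for `j ≠ i` the images `L v_i` and `L v_j` are
orthogonal whatever their scaling. -/
lemma sum_leftSingular_mul (i j : Fin n) (hi : singularValue L i ≠ 0) :
    ∑ a, leftSingular L i a * leftSingular L j a = if i = j then 1 else 0 := by
  have h : ∑ a, leftSingular L i a * leftSingular L j a =
      (singularValue L i)⁻¹ * (singularValue L j)⁻¹ *
        ∑ a, L.mulVec (rightSingular L i) a * L.mulVec (rightSingular L j) a := by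
    rw [Finset.mul_sum]
    refine Finset.sum_congr rfl fun a _ => ?_
    simp only [leftSingular, Pi.smul_apply, smul_eq_mul]
    ring
  rw [h]
  split_ifs with hij
  · subst hij
    simp only [← sq, sum_mulVec_rightSingular_sq]
    field_simp
  · rw [mulVec_rightSingular_dotProduct, sum_rightSingular_mul_of_ne L hij]
    simp

lemma sum_mul_rightSingular_sq_le (s : Finset (Fin n)) (x : Fin n → ℝ) :
    ∑ i ∈ s, (∑ c, x c * rightSingular L i c) ^ 2 ≤ ∑ c, x c ^ 2 := by
  have h := sum_rightSingular_mul L x x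
  simp only [← sq] at h
  rw [← h]
  exact Finset.sum_le_sum_of_subset_of_nonneg (Finset.subset_univ _) fun _ _ _ => sq_nonneg _

/-- The partial isometry `∑ u_i v_iᵀ`, over the nonzero singular values. -/
noncomputable def polarFactor (a c : Fin n) : ℝ :=
  ∑ i with singularValue L i ≠ 0, leftSingular L i a * rightSingular L i c

lemma polarFactor_mulVec (x : Fin n → ℝ) (a : Fin n) :
    ∑ c, polarFactor L a c * x c =
      ∑ i with singularValue L i ≠ 0, leftSingular L i a * ∑ c, x c * rightSingular L i c := by
  simp only [polarFactor, Finset.sum_mul, Finset.mul_sum]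
  rw [Finset.sum_comm]
  exact Finset.sum_congr rfl fun i _ => Finset.sum_congr rfl fun c _ => by ring

lemma matNorm_polarFactor_le : matNorm .two (polarFactor L) ≤ 1 := by
  refine matNorm_two_le zero_le_one fun x => ?_
  rw [one_mul]
  refine le_of_sq_le_sq ?_ (vecNorm_nonneg _ _)
  rw [vecNorm_two_sq, vecNorm_two_sq]
  refine le_trans (le_of_eq ?_)
    (sum_mul_rightSingular_sq_le L {i | singularValue L i ≠ 0} x)
  simp only [polarFactor_mulVec]
  set t : Fin n → ℝ := fun i => ∑ c, x c * rightSingular L i c with ht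
  calc ∑ a, (∑ i with singularValue L i ≠ 0, leftSingular L i a * t i) ^ 2
      = ∑ i with singularValue L i ≠ 0, ∑ j with singularValue L j ≠ 0,
          t i * t j * ∑ a, leftSingular L i a * leftSingular L j a := by
        simp only [sq, Finset.sum_mul_sum]
        rw [Finset.sum_comm]
        refine Finset.sum_congr rfl fun i _ => ?_
        rw [Finset.sum_comm]
        simp only [Finset.mul_sum]
        exact Finset.sum_congr rfl fun j _ => Finset.sum_congr rfl fun a _ => by ring
    _ = ∑ i with singularValue L i ≠ 0, t i ^ 2 := by
        refine Finset.sum_congr rfl fun i hi => ?_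
        have hi' := (Finset.mem_filter.1 hi).2
        simp only [sum_leftSingular_mul L i _ hi', mul_ite, mul_one, mul_zero,
          Finset.sum_ite_eq, hi, if_true, sq]

lemma matPairing_eq_sum_mulVec (A : Fin n → Fin n → ℝ) :
    matPairing L A =
      ∑ i, ∑ a, L.mulVec (rightSingular L i) a * ∑ c, A a c * rightSingular L i c := by
  rw [Finset.sum_comm]
  exact Finset.sum_congr rfl fun a _ => (sum_rightSingular_mul L (L a) (A a)).symm

lemma matPairing_polarFactor : matPairing L (polarFactor L) = ∑ i, singularValue L i := by
  have h1 : matPairing L (polarFactor L) = ∑ i with singularValue L i ≠ 0,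
      ∑ a, L.mulVec (rightSingular L i) a * leftSingular L i a := by
    simp only [matPairing, polarFactor, Finset.mul_sum]
    rw [Finset.sum_comm (t := Finset.univ) (s := Finset.filter _ _)]
    refine Finset.sum_congr rfl fun a _ => ?_
    rw [Finset.sum_comm]
    refine Finset.sum_congr rfl fun i _ => ?_
    rw [Matrix.mulVec, dotProduct, Finset.sum_mul]
    exact Finset.sum_congr rfl fun c _ => by ring
  rw [h1, ← Finset.sum_filter_ne_zero (s := Finset.univ)]
  refine Finset.sum_congr rfl fun i hi => ?_
  have hi' := (Finset.mem_filter.1 hi).2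
  calc ∑ a, L.mulVec (rightSingular L i) a * leftSingular L i a
      = (singularValue L i)⁻¹ * ∑ a, L.mulVec (rightSingular L i) a ^ 2 := by
        rw [Finset.mul_sum]
        refine Finset.sum_congr rfl fun a _ => ?_
        simp only [leftSingular, Pi.smul_apply, smul_eq_mul]
        ring
    _ = singularValue L i := by
        rw [sum_mulVec_rightSingular_sq]
        field_simp

lemma singularValue_nonneg (i : Fin n) : 0 ≤ singularValue L i := Real.sqrt_nonneg _

/-- In the basis `v_i` the pairing is `∑ ⟨L v_i, A v_i⟩`, and `‖L v_i‖ = s_i`, `‖A v_i‖ ≤ ‖A‖`. So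
it is at most `(∑ s_i) ‖A‖`, and `∑ s_i` is the value at the polar factor. -/
lemma norms_two : Norms .two L (polarFactor L) := by
  refine ⟨matNorm_polarFactor_le L, fun A => ?_⟩
  rw [matPairing_polarFactor, matPairing_eq_sum_mulVec, Finset.sum_mul]
  refine Finset.sum_le_sum fun i _ => ?_
  refine (le_abs_self _).trans (abs_le_of_sq_le_sq ?_
    (mul_nonneg (singularValue_nonneg L i) (matNorm_nonneg _ _)))
  refine (Finset.sum_mul_sq_le_sq_mul_sq _ _ _).trans ?_
  rw [sum_mulVec_rightSingular_sq, mul_pow]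
  refine mul_le_mul_of_nonneg_left ?_ (sq_nonneg _)
  have h := pow_le_pow_left₀ (vecNorm_nonneg _ _)
    (vecNorm_mulVec_le .two A (rightSingular L i)) 2
  rwa [mul_pow, vecNorm_two_sq, vecNorm_two_sq, sum_rightSingular_sq, mul_one] at h

end Singular

lemma exists_matDuality_eq_smul (rowMax : ArgmaxRule (Fin n)) (q : NormChoice)
    (L : Fin n → Fin n → ℝ) :
    ∃ Q, Norms q L Q ∧ matDuality rowMax q L = matDualNorm q L • Q := by
  cases q
  · exact ⟨_, norms_two (Matrix.of L), rfl⟩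
  · exact ⟨_, norms_infty rowMax L, rfl⟩

lemma matNorm_matDuality_le (rowMax : ArgmaxRule (Fin n)) (q : NormChoice)
    (L : Fin n → Fin n → ℝ) : matNorm q (matDuality rowMax q L) ≤ matDualNorm q L := by
  obtain ⟨Q, hQ, h⟩ := exists_matDuality_eq_smul rowMax q L
  have h0 := matDualNorm_nonneg q L
  rw [h, matNorm_smul, abs_of_nonneg h0]
  exact mul_le_of_le_one_right h0 hQ.1

lemma matPairing_matDuality (rowMax : ArgmaxRule (Fin n)) (q : NormChoice)
    (L : Fin n → Fin n → ℝ) : matPairing L (matDuality rowMax q L) = matDualNorm q L ^ 2 := by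
  obtain ⟨Q, hQ, h⟩ := exists_matDuality_eq_smul rowMax q L
  rw [h, matPairing_smul, ← hQ.matDualNorm_eq, sq]

lemma matPairing_le (rowMax : ArgmaxRule (Fin n)) (q : NormChoice) (L A : Fin n → Fin n → ℝ) :
    matPairing L A ≤ matDualNorm q L * matNorm q A := by
  obtain ⟨Q, hQ, -⟩ := exists_matDuality_eq_smul rowMax q L
  exact hQ.matDualNorm_eq ▸ hQ.2 A

end Duality

/-! ### Variance of a sample mean, as a finite sum over all batches. -/

section Sampling

/-- Variances of independent centred draws add: on splitting off one draw, the cross term sums to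
zero. -/
lemma card_mul_sum_sum_sq {m : ℕ} {d : Fin m → ℝ} (hd : ∑ j, d j = 0) (b : ℕ) :
    m * ∑ c : Fin b → Fin m, (∑ k, d (c k)) ^ 2 = b * (m : ℝ) ^ b * ∑ j, d j ^ 2 := by
  induction b with
  | zero => simp
  | succ b ih =>
    rw [← (Fin.consEquiv fun _ => Fin m).sum_comp, Fintype.sum_prod_type]
    have h : ∀ (j : Fin m) (c : Fin b → Fin m),
        (∑ k, d ((Fin.consEquiv fun _ => Fin m) (j, c) k)) ^ 2 =
          d j ^ 2 + d j * (2 * ∑ k, d (c k)) + (∑ k, d (c k)) ^ 2 := fun j c => by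
      simp only [Fin.consEquiv_apply, Fin.sum_univ_succ, Fin.cons_zero, Fin.cons_succ]
      ring
    simp only [h, Finset.sum_add_distrib, ← Finset.mul_sum, ← Finset.sum_mul, hd, Finset.sum_const,
      Finset.card_univ, Fintype.card_fin, Fintype.card_fun, nsmul_eq_mul, zero_mul, mul_add,
      add_zero]
    rw [ih]
    push_cast
    ring

/-- The variance of a sample mean is at most the second moment divided by the sample size. -/
lemma sum_sampleMean_sub_sq_le {m b : ℕ} (hm : 1 ≤ m) (hb : 1 ≤ b) (d : Fin m → ℝ) :
    ∑ c : Fin b → Fin m, (1 / (b : ℝ) * ∑ k, d (c k) - 1 / (m : ℝ) * ∑ j, d j) ^ 2 ≤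
      (m : ℝ) ^ b * (1 / b * (1 / m * ∑ j, d j ^ 2)) := by
  have hm0 : (0 : ℝ) < m := by exact_mod_cast hm
  have hb0 : (0 : ℝ) < b := by exact_mod_cast hb
  set μ := 1 / (m : ℝ) * ∑ j, d j with hμ
  have hμm : ∑ j, d j = m * μ := by rw [hμ]; field_simp
  have h0 : ∑ j, (d j - μ) = 0 := by
    simp [Finset.sum_sub_distrib, hμm]
  have h1 := card_mul_sum_sum_sq h0 b
  have h2 : ∑ j, (d j - μ) ^ 2 = ∑ j, d j ^ 2 - m * μ ^ 2 := by
    simp only [sub_sq, Finset.sum_add_distrib, Finset.sum_sub_distrib, ← Finset.sum_mul,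
      ← Finset.mul_sum, hμm, Finset.sum_const, Finset.card_univ, Fintype.card_fin, nsmul_eq_mul]
    ring
  have h3 : ∀ c : Fin b → Fin m, (1 / (b : ℝ) * ∑ k, d (c k) - μ) ^ 2 =
      1 / (b : ℝ) ^ 2 * (∑ k, (d (c k) - μ)) ^ 2 := fun c => by
    simp only [Finset.sum_sub_distrib, Finset.sum_const, Finset.card_univ, Fintype.card_fin,
      nsmul_eq_mul]
    field_simp
  simp only [h3, ← Finset.mul_sum]
  have h4 : ∑ c : Fin b → Fin m, (∑ k, (d (c k) - μ)) ^ 2 =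
      b * (m : ℝ) ^ b * (∑ j, (d j - μ) ^ 2) / m := by
    rw [← h1]
    field_simp
  rw [h4, h2]
  have h5 : 0 ≤ (m : ℝ) ^ b * (1 / b * (1 / m * (m * μ ^ 2))) := by positivity
  have h6 : 1 / (b : ℝ) ^ 2 * (b * (m : ℝ) ^ b * (∑ j, d j ^ 2 - m * μ ^ 2) / m) =
      (m : ℝ) ^ b * (1 / b * (1 / m * ∑ j, d j ^ 2)) -
        (m : ℝ) ^ b * (1 / b * (1 / m * (m * μ ^ 2))) := by
    field_simp
  rw [h6]
  linarith

end Sampling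

/-! ### Descent in one step with an inexact derivative. -/

section Step

variable {K n m b : ℕ} {q : NormChoice} {σ : ℝ → ℝ}

lemma functional_single (ℓ : Functional K n) (i : Fin K) (A : Fin n → Fin n → ℝ) :
    ℓ (Pi.single i A) = matPairing (component ℓ i) A := by
  have hA : (Pi.single i A : Params K n) =
      ∑ a, ∑ c, A a c • (Pi.single i (Pi.single a (Pi.single c 1)) : Params K n) := by
    funext j a c
    rcases eq_or_ne j i with rfl | hj
    · simp [Finset.sum_apply, Pi.single_apply, apply_ite, ite_apply]
    · simp [Finset.sum_apply, hj]
  rw [hA]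
  simp only [map_sum, map_smul, smul_eq_mul, matPairing, component]
  exact Finset.sum_congr rfl fun a _ => Finset.sum_congr rfl fun c _ => mul_comm _ _

lemma functional_apply (ℓ : Functional K n) (u : Params K n) :
    ℓ u = ∑ i, matPairing (component ℓ i) (u i) := by
  conv_lhs => rw [← Finset.univ_sum_single u]
  rw [map_sum]
  exact Finset.sum_congr rfl fun i _ => functional_single ℓ i (u i)

lemma finslerNorm_single (w : Params K n) (i : Fin K) (A : Fin n → Fin n → ℝ) :
    finslerNorm q σ w (Pi.single i A) = pPoly q σ w i * matNorm q A := by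
  rw [finslerNorm, Finset.sum_eq_single i]
  · simp
  · intro j _ hj
    have h0 : matNorm q (0 : Fin n → Fin n → ℝ) = 0 := by
      have := matNorm_smul q 0 (0 : Fin n → Fin n → ℝ)
      simpa using this
    simp [hj, h0]
  · simp

lemma dualNormAt_nonneg (w : Params K n) (ℓ : Functional K n) : 0 ≤ dualNormAt q σ w ℓ := by
  refine sSup_nonneg_of_neg_mem ?_
  rintro x ⟨u, hu, rfl⟩
  refine ⟨-u, ?_, (map_neg ℓ u).symm⟩
  rw [← hu]
  simp only [finslerNorm, Pi.neg_apply, matNorm_neg]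

lemma dualNormAt_le {w : Params K n} {ℓ : Functional K n} {M : ℝ} (hM : 0 ≤ M)
    (h : ∀ u, ℓ u ≤ M * finslerNorm q σ w u) : dualNormAt q σ w ℓ ≤ M := by
  refine Real.sSup_le ?_ hM
  rintro x ⟨u, hu, rfl⟩
  simpa [hu] using h u

/-- Descent along the duality map of a perturbed derivative, for a function that is smooth in each
layer. -/
lemma descent_step {f : Params K n → ℝ} {w : Params K n} {F G : Functional K n}
    (hf : ∀ (i : Fin K) (A : Fin n → Fin n → ℝ), f (w + Pi.single i A) ≤ f w + F (Pi.single i A) +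
      (pPoly q σ w i * matNorm q A) ^ 2 / 2)
    {D : ℝ} (hD : 0 ≤ D) (hG : ∀ u, (G - F) u ≤ D * finslerNorm q σ w u)
    (rowMax : ArgmaxRule (Fin n)) (layerMax : ArgmaxRule (Fin K))
    {α : ℝ} (hα₀ : 0 < α) (hα₁ : α < 1) :
    f (w - (2 * α) • dualityMap q σ rowMax layerMax w G) ≤
      f w - α * (1 - α) * (dualNormAt q σ w F ^ 2 - 5 / (1 - α) ^ 2 * D ^ 2) := by
  set s := layerMax.toFun (fun i => 1 / pPoly q σ w i * matDualNorm q (component G i)) with hs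
  set R := matDuality rowMax q (component G s) with hR
  set p := pPoly q σ w s with hp
  have hp0 : 0 < p := pPoly_pos w s
  set N := 1 / p * matDualNorm q (component G s) with hN
  have hN0 : 0 ≤ N := mul_nonneg (by positivity) (matDualNorm_nonneg _ _)
  have hNp : matDualNorm q (component G s) = p * N := by rw [hN]; field_simp
  have hstep : w - (2 * α) • dualityMap q σ rowMax layerMax w G =
      w + Pi.single s (-(2 * α / p ^ 2) • R) := by
    have : dualityMap q σ rowMax layerMax w G = Pi.single s ((1 / p ^ 2) • R) := rfl
    rw [this, sub_eq_add_neg, ← Pi.single_smul, ← Pi.single_neg, smul_smul, neg_smul]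
    congr 4
    ring
  have hRn : matNorm q R ≤ p * N := hNp ▸ matNorm_matDuality_le rowMax q _
  have hR0 := matNorm_nonneg q R
  have hGR : G (Pi.single s R) = (p * N) ^ 2 := by
    rw [functional_single, hR, matPairing_matDuality, hNp]
  have hδR := hG (Pi.single s R)
  rw [finslerNorm_single, ← hp, sub_apply, hGR] at hδR
  -- `G` pairs with `R` to `(p N)²`, and replacing `G` by `F` costs at most `D` times the local norm
  -- of `R`, itself at most `p² N`.
  have hFR : p ^ 2 * (N ^ 2 - D * N) ≤ F (Pi.single s R) := by
    have h1 : D * (p * matNorm q R) ≤ D * (p * (p * N)) := by gcongr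
    nlinarith
  have h1 := hf s (-(2 * α / p ^ 2) • R)
  have hF1 : F (Pi.single s (-(2 * α / p ^ 2) • R)) ≤ -(2 * α * (N ^ 2 - D * N)) := by
    rw [Pi.single_smul, map_smul, smul_eq_mul, neg_mul, neg_le_neg_iff]
    have := mul_le_mul_of_nonneg_left hFR (by positivity : 0 ≤ 2 * α / p ^ 2)
    refine le_trans (le_of_eq ?_) this
    field_simp
  have hF2 : (p * matNorm q (-(2 * α / p ^ 2) • R)) ^ 2 ≤ (2 * α * N) ^ 2 := by
    rw [matNorm_smul, abs_neg, abs_of_nonneg (by positivity : 0 ≤ 2 * α / p ^ 2)]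
    refine pow_le_pow_left₀ (by positivity) ?_ 2
    calc p * (2 * α / p ^ 2 * matNorm q R) ≤ p * (2 * α / p ^ 2 * (p * N)) := by gcongr
      _ = 2 * α * N := by field_simp
  have hX0 := dualNormAt_nonneg (q := q) (σ := σ) w F
  have hX : dualNormAt q σ w F ≤ N + D := by
    refine dualNormAt_le (by positivity) fun u => ?_
    have h2 : F u = G u + (G - F) (-u) := by
      rw [sub_apply, map_neg, map_neg]
      ring
    have h3 := hG (-u)
    have h4 : finslerNorm q σ w (-u) = finslerNorm q σ w u := by
      simp only [finslerNorm, Pi.neg_apply, matNorm_neg]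
    rw [h4] at h3
    have h5 : G u ≤ N * finslerNorm q σ w u := by
      rw [functional_apply, finslerNorm, Finset.mul_sum]
      refine Finset.sum_le_sum fun i _ => (matPairing_le rowMax q _ _).trans ?_
      rw [← mul_assoc]
      refine mul_le_mul_of_nonneg_right ?_ (matNorm_nonneg _ _)
      have h6 : 1 / pPoly q σ w i * matDualNorm q (component G i) ≤ N :=
        layerMax.le_toFun (fun i => 1 / pPoly q σ w i * matDualNorm q (component G i)) i
      have h7 := pPoly_pos (q := q) (σ := σ) w i
      rw [one_div, inv_mul_le_iff₀ h7] at h6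
      linarith
    rw [h2, add_mul]
    exact add_le_add h5 h3
  rw [hstep]
  have hβ : 0 < 1 - α := by linarith
  set X := dualNormAt q σ w F
  -- The weights fit together: the Taylor bound yields `-2α(1-α) N² + 2α D N`. Young's inequality in
  -- `hDN` spends a quarter of the first term, and the remaining `3/2` matches the coefficient of `N
  -- ^ 2` here.
  have hXsq : X ^ 2 ≤ 3 / 2 * N ^ 2 + 3 * D ^ 2 := by
    nlinarith [sq_nonneg (N - 2 * D)]
  have hDN : 2 * (D * N) ≤ (1 - α) / 2 * N ^ 2 + 2 / (1 - α) * D ^ 2 := by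
    have h8 : 0 ≤ (1 - α) / 2 * (N - 2 / (1 - α) * D) ^ 2 := by positivity
    have h9 : (1 - α) / 2 * (N - 2 / (1 - α) * D) ^ 2 =
        (1 - α) / 2 * N ^ 2 + 2 / (1 - α) * D ^ 2 - 2 * (D * N) := by
      field_simp
      ring
    linarith
  have hcoef : 3 * (1 - α) + 2 / (1 - α) ≤ 5 / (1 - α) := by
    have : 3 * (1 - α) ≤ 3 / (1 - α) := by
      rw [le_div_iff₀ hβ]
      nlinarith
    have h9 : 5 / (1 - α) = 3 / (1 - α) + 2 / (1 - α) := by ring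
    linarith
  have h10 : α * (1 - α) * (X ^ 2 - 5 / (1 - α) ^ 2 * D ^ 2) =
      α * ((1 - α) * X ^ 2) - α * (5 / (1 - α) * D ^ 2) := by
    field_simp
  have h11 := mul_le_mul_of_nonneg_left hDN hα₀.le
  have h12 := mul_le_mul_of_nonneg_left
    (mul_le_mul_of_nonneg_left hXsq hβ.le) hα₀.le
  have h13 := mul_le_mul_of_nonneg_left
    (mul_le_mul_of_nonneg_right hcoef (sq_nonneg D)) hα₀.le
  rw [h10]
  linarith

end Step

/-! ### Mean square of the batch error and expected decrease. -/

section Noise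

variable {K n m b : ℕ} {q : NormChoice} {σ : ℝ → ℝ}

/-- A Euclidean upper bound for the square of the dual norm of `ℓ` at `w`. -/
noncomputable def noiseSq (q : NormChoice) (σ : ℝ → ℝ) (w : Params K n) (ℓ : Functional K n) : ℝ :=
  ∑ i, n / pPoly q σ w i ^ 2 * ∑ a, ∑ c, component ℓ i a c ^ 2

lemma noiseSq_nonneg (w : Params K n) (ℓ : Functional K n) : 0 ≤ noiseSq q σ w ℓ :=
  Finset.sum_nonneg fun _ _ => by positivity

lemma matPairing_sq_le (L A : Fin n → Fin n → ℝ) :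
    matPairing L A ^ 2 ≤ (∑ a, ∑ c, L a c ^ 2) * ∑ a, ∑ c, A a c ^ 2 := by
  simp only [matPairing, ← Finset.sum_product' Finset.univ Finset.univ]
  exact Finset.sum_mul_sq_le_sq_mul_sq _ (fun x : Fin n × Fin n => L x.1 x.2) fun x => A x.1 x.2

lemma functional_le_sqrt_noiseSq (w : Params K n) (ℓ : Functional K n) (u : Params K n) :
    ℓ u ≤ √(noiseSq q σ w ℓ) * finslerNorm q σ w u := by
  rw [functional_apply, finslerNorm, Finset.mul_sum]
  refine Finset.sum_le_sum fun i _ => ?_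
  have hp := pPoly_pos (q := q) (σ := σ) w i
  have hu := matNorm_nonneg q (u i)
  refine (le_abs_self _).trans (abs_le_of_sq_le_sq ?_ (by positivity))
  rw [mul_pow, Real.sq_sqrt (noiseSq_nonneg w ℓ), mul_pow]
  refine (matPairing_sq_le _ _).trans ?_
  calc (∑ a, ∑ c, component ℓ i a c ^ 2) * ∑ a, ∑ c, u i a c ^ 2
      ≤ (∑ a, ∑ c, component ℓ i a c ^ 2) * (n * matNorm q (u i) ^ 2) :=
        mul_le_mul_of_nonneg_left (sum_sq_le_matNorm_sq q (u i)) (by positivity)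
    _ = (n / pPoly q σ w i ^ 2 * ∑ a, ∑ c, component ℓ i a c ^ 2) *
        (pPoly q σ w i ^ 2 * matNorm q (u i) ^ 2) := by field_simp
    _ ≤ _ := by
      refine mul_le_mul_of_nonneg_right ?_ (by positivity)
      exact Finset.single_le_sum
        (f := fun i => n / pPoly q σ w i ^ 2 * ∑ a, ∑ c, component ℓ i a c ^ 2)
        (fun _ _ => by positivity) (Finset.mem_univ i)

/-- The derivative is tested on its own matrix `L`, where its value is the squared Frobenius norm
`S`. This gives `S² ≤ 8n p² ‖L‖_q² ≤ 8n² p² S`, and one factor `S` cancels. -/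
lemma sum_component_sq_le (hn : 1 ≤ n) (hσ : Differentiable ℝ σ)
    (hσ' : Differentiable ℝ (deriv σ)) (hσ_bound : ∀ u, |σ u| ≤ 1)
    (hb : BddAbove (Set.range fun u => |deriv σ u|))
    (hb' : BddAbove (Set.range fun u => |deriv (deriv σ) u|))
    (w : Params K n) (i : Fin K) {y z : Fin n → ℝ}
    (hy : ∀ i, |y i| ≤ 1) (hz : ∀ i, |z i| ≤ 1) :
    ∑ a, ∑ c, component (fderiv ℝ (sampleLoss σ y z) w) i a c ^ 2 ≤
      8 * n ^ 2 * pPoly q σ w i ^ 2 := by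
  set L := component (fderiv ℝ (sampleLoss σ y z) w) i with hL
  have h1 := fderiv_sampleLoss_sq_le (q := q) hσ hσ' hσ_bound hb hb' w i L hy hz
  have h2 := matNorm_sq_le_sum_sq q hn L
  have h3 : matPairing L L = ∑ a, ∑ c, L a c ^ 2 := by simp only [matPairing, sq]
  rw [functional_single, ← hL, h3, mul_pow] at h1
  set S := ∑ a, ∑ c, L a c ^ 2
  have hS : 0 ≤ S := by positivity
  rcases hS.eq_or_lt with h0 | h0
  · rw [← h0]; positivity
  · have h4 : 8 * (n : ℝ) * (pPoly q σ w i ^ 2 * matNorm q L ^ 2) ≤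
        8 * n * (pPoly q σ w i ^ 2 * (n * S)) := by gcongr
    refine le_of_mul_le_mul_right ?_ h0
    nlinarith

lemma sum_noiseSq_le (hn : 1 ≤ n) (hm : 1 ≤ m) (hb1 : 1 ≤ b) (hσ : Differentiable ℝ σ)
    (hσ' : Differentiable ℝ (deriv σ)) (hσ_bound : ∀ u, |σ u| ≤ 1)
    (hb : BddAbove (Set.range fun u => |deriv σ u|))
    (hb' : BddAbove (Set.range fun u => |deriv (deriv σ) u|))
    {y z : Fin m → Fin n → ℝ} (hy : ∀ i j, |y i j| ≤ 1) (hz : ∀ i j, |z i j| ≤ 1)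
    (w : Params K n) :
    ∑ c : Fin b → Fin m,
        noiseSq q σ w (batchGrad σ y z w c - fderiv ℝ (empError σ y z) w) ≤
      (m : ℝ) ^ b * (8 * n ^ 3 * K / b) := by
  have hm0 : (0 : ℝ) < m := by exact_mod_cast hm
  have hb0 : (0 : ℝ) < b := by exact_mod_cast hb1
  set d : Fin K → Fin n → Fin n → Fin m → ℝ := fun i a e j =>
    component (fderiv ℝ (sampleLoss σ (y j) (z j)) w) i a e with hd
  have hcomp : ∀ (c : Fin b → Fin m) i a e,
      component (batchGrad σ y z w c - fderiv ℝ (empError σ y z) w) i a e =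
        1 / (b : ℝ) * ∑ k, d i a e (c k) - 1 / (m : ℝ) * ∑ j, d i a e j := fun c i a e => by
    simp only [fderiv_empError hσ, batchGrad, component, sub_apply, smul_apply, sum_apply,
      smul_eq_mul, hd]
  simp only [noiseSq, hcomp]
  rw [Finset.sum_comm]
  calc ∑ i, ∑ c : Fin b → Fin m, n / pPoly q σ w i ^ 2 *
        ∑ a, ∑ e, (1 / (b : ℝ) * ∑ k, d i a e (c k) - 1 / (m : ℝ) * ∑ j, d i a e j) ^ 2
      -- The weight `n / p_i²` cancels the `p_i²` in the second moment `8n² p_i²`, so the noise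
      -- bound does not depend on `w`.
      ≤ ∑ _i : Fin K, (m : ℝ) ^ b * (8 * n ^ 3 / b) := by
        refine Finset.sum_le_sum fun i _ => ?_
        have hp := pPoly_pos (q := q) (σ := σ) w i
        rw [← Finset.mul_sum, Finset.sum_comm]
        have h1 : ∑ a, ∑ c : Fin b → Fin m, ∑ e,
            (1 / (b : ℝ) * ∑ k, d i a e (c k) - 1 / (m : ℝ) * ∑ j, d i a e j) ^ 2 ≤
            ∑ a, ∑ e, (m : ℝ) ^ b * (1 / b * (1 / m * ∑ j, d i a e j ^ 2)) := by
          refine Finset.sum_le_sum fun a _ => ?_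
          rw [Finset.sum_comm]
          exact Finset.sum_le_sum fun e _ => sum_sampleMean_sub_sq_le hm hb1 _
        have h2 : ∑ a, ∑ e, ∑ j, d i a e j ^ 2 ≤ m * (8 * n ^ 2 * pPoly q σ w i ^ 2) := by
          have h3 : ∑ a, ∑ e, ∑ j, d i a e j ^ 2 = ∑ j, ∑ a, ∑ e, d i a e j ^ 2 := by
            rw [Finset.sum_comm (s := Finset.univ (α := Fin m))]
            exact Finset.sum_congr rfl fun a _ => Finset.sum_comm
          rw [h3]
          calc ∑ j, ∑ a, ∑ e, d i a e j ^ 2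
              ≤ ∑ _j : Fin m, 8 * n ^ 2 * pPoly q σ w i ^ 2 :=
                Finset.sum_le_sum fun j _ =>
                  sum_component_sq_le hn hσ hσ' hσ_bound hb hb' w i (hy j) (hz j)
            _ = _ := by simp
        simp only [← Finset.mul_sum] at h1
        calc _ ≤ n / pPoly q σ w i ^ 2 * ((m : ℝ) ^ b * (1 / b * (1 / m *
              (m * (8 * n ^ 2 * pPoly q σ w i ^ 2))))) := by
              refine mul_le_mul_of_nonneg_left (h1.trans ?_) (by positivity)
              gcongr
          _ = _ := by field_simp
    _ = (m : ℝ) ^ b * (8 * n ^ 3 * K / b) := by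
        simp only [Finset.sum_const, Finset.card_univ, Fintype.card_fin, nsmul_eq_mul]
        ring

/-- Expected decrease of the empirical error in one stochastic step. -/
lemma sum_empError_step_le (hn : 1 ≤ n) (hm : 1 ≤ m) (hb1 : 1 ≤ b) (hσ : Differentiable ℝ σ)
    (hσ' : Differentiable ℝ (deriv σ)) (hσ_bound : ∀ u, |σ u| ≤ 1)
    (hb : BddAbove (Set.range fun u => |deriv σ u|))
    (hb' : BddAbove (Set.range fun u => |deriv (deriv σ) u|))
    {y z : Fin m → Fin n → ℝ} (hy : ∀ i j, |y i j| ≤ 1) (hz : ∀ i j, |z i j| ≤ 1)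
    (rowMax : ArgmaxRule (Fin n)) (layerMax : ArgmaxRule (Fin K))
    {α : ℝ} (hα₀ : 0 < α) (hα₁ : α < 1) (w : Params K n) :
    ∑ c : Fin b → Fin m, empError σ y z
        (w - (2 * α) • dualityMap q σ rowMax layerMax w (batchGrad σ y z w c)) ≤
      (m : ℝ) ^ b * (empError σ y z w -
        α * (1 - α) * (dualNormAt q σ w (fderiv ℝ (empError σ y z) w) ^ 2 -
          5 / (1 - α) ^ 2 * (8 * n ^ 3 * K / b))) := by
  have hβ : 0 < 1 - α := by linarith
  have h := Finset.sum_le_sum fun (c : Fin b → Fin m) (_ : c ∈ Finset.univ) =>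
    descent_step (q := q) (σ := σ)
      (empError_step hm hσ hσ' hσ_bound hb hb' hy hz w) (Real.sqrt_nonneg _)
      (functional_le_sqrt_noiseSq w (batchGrad σ y z w c - fderiv ℝ (empError σ y z) w))
      rowMax layerMax hα₀ hα₁
  refine h.trans ?_
  simp only [Real.sq_sqrt (noiseSq_nonneg w _), Finset.sum_sub_distrib, ← Finset.mul_sum,
    Finset.sum_const, Finset.card_univ, Fintype.card_fun, Fintype.card_fin, nsmul_eq_mul,
    Nat.cast_pow]
  have h1 := sum_noiseSq_le (q := q) hn hm hb1 hσ hσ' hσ_bound hb hb' hy hz w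
  have h2 := mul_le_mul_of_nonneg_left h1
    (by positivity : 0 ≤ α * (1 - α) * (5 / (1 - α) ^ 2))
  linarith

end Noise

/-! ### Expected exit time of a chain driven by independent uniform inputs. -/

section Hitting

/-- State and survival at time `t` depend only on the first `t` inputs. When `C` is finite these
take finitely many values, so no measurability of `S`, `A` or the potential is ever required. -/
lemma exists_eq_history {Ω E C : Type*} {B : ℕ → Ω → C} {S : E → C → E} {x : ℕ → Ω → E} {x₀ : E}
    (h0 : ∀ ω, x 0 ω = x₀) (hx : ∀ t ω, x (t + 1) ω = S (x t ω) (B t ω))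
    (A : E → Prop) (t : ℕ) :
    ∃ F : (Fin t → C) → E × Prop, ∀ ω, (x t ω, ∀ s ≤ t, A (x s ω)) = F fun s => B s ω := by
  induction t with
  | zero => exact ⟨fun _ => (x₀, A x₀), fun ω => by simp [h0]⟩
  | succ t ih =>
    obtain ⟨F, hF⟩ := ih
    refine ⟨fun h => (S (F fun s => h s.castSucc).1 (h (Fin.last t)),
      (F fun s => h s.castSucc).2 ∧ A (S (F fun s => h s.castSucc).1 (h (Fin.last t)))),
      fun ω => ?_⟩
    simp only [Fin.val_castSucc, ← hF ω, Fin.val_last, ← hx, Prod.mk.injEq, true_and, eq_iff_iff]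
    constructor
    · exact fun h => ⟨fun s hs => h s (by omega), h _ le_rfl⟩
    · rintro ⟨h, h'⟩ s hs
      rcases Nat.lt_or_ge t s with h2 | h2
      · rwa [show s = t + 1 by omega]
      · exact h s h2

variable {Ω : Type*} [MeasurableSpace Ω] {P : Measure Ω}

/-- Plays the role of conditional expectation given the history `X`: the fresh input `Y` is averaged
out by Fubini. -/
lemma lintegral_of_indep_uniform [IsProbabilityMeasure P] {H C : Type*}
    [Finite H] [MeasurableSpace H] [MeasurableSingletonClass H]
    [Fintype C] [MeasurableSpace C] [MeasurableSingletonClass C]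
    {X : Ω → H} {Y : Ω → C} (hX : Measurable X) (hY : Measurable Y) (hXY : IndepFun X Y P)
    {r : ℝ≥0∞} (hr : ∀ c, P {ω | Y ω = c} = r) (Φ : H → C → ℝ≥0∞) :
    ∫⁻ ω, Φ (X ω) (Y ω) ∂P = ∫⁻ ω, r * ∑ c, Φ (X ω) c ∂P := by
  have hΦ : Measurable (Function.uncurry Φ) := measurable_of_countable _
  have := Measure.isProbabilityMeasure_map (μ := P) hX.aemeasurable
  have := Measure.isProbabilityMeasure_map (μ := P) hY.aemeasurable
  calc ∫⁻ ω, Φ (X ω) (Y ω) ∂P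
      = ∫⁻ x, Function.uncurry Φ x ∂(P.map fun ω => (X ω, Y ω)) :=
        (lintegral_map hΦ (hX.prodMk hY)).symm
    _ = ∫⁻ h, ∫⁻ c, Φ h c ∂(P.map Y) ∂(P.map X) := by
        rw [(indepFun_iff_map_prod_eq_prod_map_map hX.aemeasurable hY.aemeasurable).1 hXY,
          lintegral_prod _ hΦ.aemeasurable]
        rfl
    _ = ∫⁻ h, r * ∑ c, Φ h c ∂(P.map X) := by
        refine lintegral_congr fun h => ?_
        rw [lintegral_fintype, Finset.mul_sum]
        refine Finset.sum_congr rfl fun c _ => ?_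
        rw [Measure.map_apply hY (measurableSet_singleton c), mul_comm]
        congr 1
        exact hr c
    _ = _ := lintegral_map (measurable_of_countable _) hX

lemma indepFun_history {C : Type*} [MeasurableSpace C] {B : ℕ → Ω → C}
    (hB : ∀ t, Measurable (B t)) (hind : iIndepFun B P) (t : ℕ) :
    IndepFun (fun ω (s : Fin t) => B s ω) (B t) P := by
  have h := hind.indepFun_finset (Finset.range t) {t} (by simp) hB
  exact h.comp (φ := fun (g : Finset.range t → C) (s : Fin t) => g ⟨s, Finset.mem_range.2 s.2⟩)
    (ψ := fun g : ({t} : Finset ℕ) → C => g ⟨t, Finset.mem_singleton_self t⟩)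
    (measurable_pi_lambda _ fun _ => measurable_pi_apply _) (measurable_pi_apply _)

variable {E C : Type*} [Fintype C] [MeasurableSpace C] [MeasurableSingletonClass C]
  {B : ℕ → Ω → C} {S : E → C → E} {x : ℕ → Ω → E} {x₀ : E}

open Classical in
/-- A Markov chain driven by independent uniform inputs, whose expected potential drops by `κ` in
each step from `A`, has expected exit time from `A` at most `V x₀ / κ`. -/
lemma mul_tsum_lintegral_le [IsProbabilityMeasure P] (hB : ∀ t, Measurable (B t))
    (hind : iIndepFun B P) {r : ℝ≥0∞} (hr : ∀ t c, P {ω | B t ω = c} = r)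
    (h0 : ∀ ω, x 0 ω = x₀) (hx : ∀ t ω, x (t + 1) ω = S (x t ω) (B t ω))
    {A : E → Prop} {V : E → ℝ≥0∞} {κ : ℝ≥0∞}
    (hV : ∀ w, A w → r * ∑ c, V (S w c) + κ ≤ V w) :
    κ * ∑' t, ∫⁻ ω, (if ∀ s ≤ t, A (x s ω) then 1 else 0) ∂P ≤ V x₀ := by
  set a : ℕ → ℝ≥0∞ := fun t => ∫⁻ ω, (if ∀ s ≤ t, A (x s ω) then V (x t ω) else 0) ∂P with ha
  -- The potential restricted to survival loses `κ` times the survival probability at each step;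
  -- dropping the condition at time `t + 1` only enlarges the left side. Telescoping then bounds the
  -- sum of these probabilities.
  have hstep : ∀ t, a (t + 1) + κ * ∫⁻ ω, (if ∀ s ≤ t, A (x s ω) then 1 else 0) ∂P ≤ a t := by
    intro t
    obtain ⟨F, hF⟩ := exists_eq_history h0 hx A t
    have hF1 : ∀ ω, x t ω = (F fun s => B s ω).1 := fun ω => congrArg Prod.fst (hF ω)
    have hF2 : ∀ ω, (∀ s ≤ t, A (x s ω)) = (F fun s => B s ω).2 := fun ω =>
      congrArg Prod.snd (hF ω)
    have hH : Measurable fun ω (s : Fin t) => B s ω := measurable_pi_lambda _ fun s => hB s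
    have hmeas : ∀ Ψ : (Fin t → C) → ℝ≥0∞, Measurable fun ω => Ψ fun s => B s ω := fun Ψ =>
      (measurable_of_countable Ψ).comp hH
    have h1 : a (t + 1) ≤ ∫⁻ ω, (if ∀ s ≤ t, A (x s ω) then V (x (t + 1) ω) else 0) ∂P := by
      refine lintegral_mono fun ω => ?_
      by_cases h : ∀ s ≤ t + 1, A (x s ω)
      · rw [if_pos h, if_pos fun s hs => h s (by omega)]
      · rw [if_neg h]; exact zero_le
    have h2 := lintegral_of_indep_uniform hH (hB t) (indepFun_history hB hind t) (hr t)
      fun h c => if (F h).2 then V (S (F h).1 c) else 0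
    simp only [← hF1, ← hF2, ← hx] at h2
    rw [h2] at h1
    refine (add_le_add_left h1 _).trans ?_
    rw [← lintegral_const_mul, ← lintegral_add_left]
    · refine lintegral_mono fun ω => ?_
      by_cases h : ∀ s ≤ t, A (x s ω)
      · simpa only [if_pos h, mul_one] using hV _ (h t le_rfl)
      · simp only [if_neg h, Finset.sum_const_zero, mul_zero, add_zero, le_refl]
    · simp only [hF1, hF2]
      exact hmeas fun h => r * ∑ c, if (F h).2 then V (S (F h).1 c) else 0
    · simp only [hF2]
      exact hmeas fun h => if (F h).2 then 1 else 0
  rw [← ENNReal.tsum_mul_left]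
  refine ENNReal.tsum_le_of_sum_range_le fun T => ?_
  have hsum : ∀ T, a T + ∑ t ∈ Finset.range T,
      κ * ∫⁻ ω, (if ∀ s ≤ t, A (x s ω) then 1 else 0) ∂P ≤ a 0 := by
    intro T
    induction T with
    | zero => simp
    | succ T ih =>
      rw [Finset.sum_range_succ, add_comm (Finset.sum _ _), ← add_assoc]
      exact (add_le_add_left (hstep T) _).trans ih
  refine (le_add_self.trans (hsum T)).trans ?_
  calc a 0 ≤ ∫⁻ _, V x₀ ∂P := lintegral_mono fun ω => by
        simp only [h0]
        split_ifs
        · exact le_rfl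
        · exact zero_le
    _ = V x₀ := by simp

open Classical in
lemma lintegral_tsum_survival (hB : ∀ t, Measurable (B t))
    (h0 : ∀ ω, x 0 ω = x₀) (hx : ∀ t ω, x (t + 1) ω = S (x t ω) (B t ω)) (A : E → Prop) :
    ∫⁻ ω, ∑' t, (if ∀ s ≤ t, A (x s ω) then 1 else 0 : ℝ≥0∞) ∂P =
      ∑' t, ∫⁻ ω, (if ∀ s ≤ t, A (x s ω) then 1 else 0) ∂P := by
  refine lintegral_tsum fun t => ?_
  obtain ⟨F, hF⟩ := exists_eq_history h0 hx A t
  have hF2 : ∀ ω, (∀ s ≤ t, A (x s ω)) = (F fun s => B s ω).2 := fun ω =>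
    congrArg Prod.snd (hF ω)
  simp only [hF2]
  exact ((measurable_of_countable fun h => if (F h).2 then (1 : ℝ≥0∞) else 0).comp
    (measurable_pi_lambda (fun ω (s : Fin t) => B s ω) fun s => hB s)).aemeasurable

end Hitting

/-! ### The hitting time and the final bound. -/

section Main

variable {K n m b : ℕ} {q : NormChoice} {σ : ℝ → ℝ}

open Classical in
-- The leading `1` reflects that the run starts at time 1: survival index `t` refers to `w (t + 1)`.
-- If the threshold is never reached, the series is infinite.
lemma hittingTime_le_tsum {Ω : Type*} (y z : Fin m → Fin n → ℝ) (γ : ℝ)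
    (w : ℕ → Ω → Params K n) (ω : Ω) :
    (hittingTime q σ y z γ w ω : ℝ≥0∞) ≤ 1 + ∑' t : ℕ,
      if ∀ s ≤ t, γ < dualNormAt q σ (w (s + 1) ω)
        (fderiv ℝ (empError σ y z) (w (s + 1) ω)) ^ 2 then 1 else 0 := by
  set A : ℕ → Prop := fun s => γ < dualNormAt q σ (w (s + 1) ω)
    (fderiv ℝ (empError σ y z) (w (s + 1) ω)) ^ 2 with hA
  by_cases h : ∃ k, ¬ A k
  · have hk := Nat.find_spec h
    have hmin : ∀ s < Nat.find h, A s := fun s hs => not_not.1 (Nat.find_min h hs)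
    set k := Nat.find h
    have h1 : hittingTime q σ y z γ w ω ≤ ((k + 1 : ℕ) : ℕ∞) :=
      sInf_le ⟨k + 1, rfl, by omega, not_lt.1 hk⟩
    calc (hittingTime q σ y z γ w ω : ℝ≥0∞) ≤ (((k + 1 : ℕ) : ℕ∞) : ℝ≥0∞) :=
          ENat.toENNReal_le.2 h1
      _ = 1 + ∑ t ∈ Finset.range k, if ∀ s ≤ t, A s then 1 else 0 := by
          rw [Finset.sum_congr rfl fun t ht =>
            if_pos fun s hs => hmin s (hs.trans_lt (Finset.mem_range.1 ht))]
          simp [add_comm]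
      _ ≤ _ := by
          gcongr
          exact ENNReal.sum_le_tsum _
  · push Not at h
    have h1 : ∀ t : ℕ, ∀ s ≤ t, A s := fun t s _ => h s
    have h2 : ∑' t : ℕ, (if ∀ s ≤ t, A s then 1 else 0 : ℝ≥0∞) = ⊤ := by
      simp only [if_pos (h1 _)]
      exact ENNReal.tsum_const_eq_top_of_ne_zero one_ne_zero
    rw [h2]
    simp

end Main

end LayerNet

theorem mainTheorem4 {K n m b : ℕ} (hK : 1 ≤ K) (hn : 1 ≤ n) (hm : 1 ≤ m) (hb : 1 ≤ b)
    (q : LayerNet.NormChoice)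
    (σ : ℝ → ℝ) (hσ_diff : Differentiable ℝ σ) (hσ_diff' : Differentiable ℝ (deriv σ))
    (hσ_bound : ∀ u, |σ u| ≤ 1)
    (hσ_deriv : BddAbove (Set.range fun u => |deriv σ u|))
    (hσ_deriv2 : BddAbove (Set.range fun u => |deriv (deriv σ) u|))
    (y z : Fin m → Fin n → ℝ) (hy : ∀ i j, |y i j| ≤ 1) (hz : ∀ i j, |z i j| ≤ 1)
    (rowMax : LayerNet.ArgmaxRule (Fin n)) (layerMax : LayerNet.ArgmaxRule (Fin K))
    (α : ℝ) (hα₀ : 0 < α) (hα₁ : α < 1)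
    (w₁ : LayerNet.Params K n)
    {Ω : Type*} [MeasurableSpace Ω] (P : Measure Ω) [IsProbabilityMeasure P]
    (B : ℕ → Ω → Fin b → Fin m) (w : ℕ → Ω → LayerNet.Params K n)
    (hrun : LayerNet.IsStochasticRun q σ y z rowMax layerMax (2 * α) w₁ P B w)
    (sigmaSq : ℝ) (hsigmaSq : sigmaSq = 32 / (b : ℝ) * (n : ℝ) ^ 5 * (K : ℝ) ^ 2)
    (γ : ℝ) (hγ : 13 / (1 - α) ^ 2 * sigmaSq ≤ γ) :
    ∫⁻ ω, (LayerNet.hittingTime q σ y z γ w ω : ℝ≥0∞) ∂P <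
      ENNReal.ofReal (4 * LayerNet.empError σ y z w₁ + γ) /
        ENNReal.ofReal (4 * α * (1 - α) * (γ - 13 / (1 - α) ^ 2 * sigmaSq)) := by
  classical
  open LayerNet in
  have hK1 : (1 : ℝ) ≤ K := by exact_mod_cast hK
  have hn1 : (1 : ℝ) ≤ n := by exact_mod_cast hn
  have hm0 : (0 : ℝ) < m := by exact_mod_cast hm
  have hb0 : (0 : ℝ) < b := by exact_mod_cast hb
  have hβ : 0 < 1 - α := by linarith
  set f : Params K n → ℝ := empError σ y z with hf
  set v : ℝ := 8 * n ^ 3 * K / b with hv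
  have hv0 : 0 < v := by positivity
  have hvs : v ≤ sigmaSq := by
    have h1 : (n : ℝ) ^ 3 ≤ n ^ 5 := pow_le_pow_right₀ hn1 (by norm_num)
    have h2 : (K : ℝ) ≤ K ^ 2 := by nlinarith
    have h3 : (n : ℝ) ^ 3 * K ≤ n ^ 5 * K ^ 2 := mul_le_mul h1 h2 (by positivity) (by positivity)
    have h4 : 0 ≤ (n : ℝ) ^ 3 * K := by positivity
    rw [hsigmaSq, hv, mul_assoc, mul_assoc, div_mul_eq_mul_div]
    refine div_le_div_of_nonneg_right ?_ hb0.le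
    linarith
  have hs0 : 0 < sigmaSq := hv0.trans_le hvs
  have hγ0 : 0 < γ := lt_of_lt_of_le (by positivity) hγ
  -- Strictness keeps `κ` positive when `γ` equals its lower bound, which gives a finite expectation
  -- in that case.
  have hcv : 5 / (1 - α) ^ 2 * v < 13 / (1 - α) ^ 2 * sigmaSq := by
    calc 5 / (1 - α) ^ 2 * v ≤ 5 / (1 - α) ^ 2 * sigmaSq := by gcongr
      _ < 13 / (1 - α) ^ 2 * sigmaSq := by gcongr; norm_num
  set κ : ℝ := α * (1 - α) * (γ - 5 / (1 - α) ^ 2 * v) with hκ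
  have hκ0 : 0 < κ := mul_pos (mul_pos hα₀ hβ) (by linarith)
  have hf0 : ∀ w, 0 ≤ f w := empError_nonneg y z
  set A : Params K n → Prop := fun w => γ < dualNormAt q σ w (fderiv ℝ f w) ^ 2 with hA
  set S : Params K n → (Fin b → Fin m) → Params K n := fun w c =>
    w - (2 * α) • dualityMap q σ rowMax layerMax w (batchGrad σ y z w c) with hS
  have hV : ∀ w, A w → ((m : ℝ≥0∞) ^ b)⁻¹ * ∑ c, ENNReal.ofReal (f (S w c)) + ENNReal.ofReal κ ≤
      ENNReal.ofReal (f w) := by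
    intro w hw
    have h := sum_empError_step_le (q := q) hn hm hb hσ_diff hσ_diff' hσ_bound hσ_deriv hσ_deriv2
      hy hz rowMax layerMax hα₀ hα₁ w
    have h1 : ∑ c, f (S w c) ≤ (m : ℝ) ^ b * (f w - κ) := by
      refine h.trans (mul_le_mul_of_nonneg_left (sub_le_sub_left ?_ _) (by positivity))
      exact mul_le_mul_of_nonneg_left (sub_le_sub_right (le_of_lt hw) _) (by positivity)
    have h2 : ((m : ℝ≥0∞) ^ b)⁻¹ = ENNReal.ofReal ((m : ℝ) ^ b)⁻¹ := by
      rw [ENNReal.ofReal_inv_of_pos (by positivity), ENNReal.ofReal_pow hm0.le,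
        ENNReal.ofReal_natCast]
    rw [h2, ← ENNReal.ofReal_sum_of_nonneg fun c _ => hf0 _,
      ← ENNReal.ofReal_mul (by positivity), ← ENNReal.ofReal_add
        (mul_nonneg (by positivity) (Finset.sum_nonneg fun c _ => hf0 _)) hκ0.le]
    refine ENNReal.ofReal_le_ofReal ?_
    have h3 : ((m : ℝ) ^ b)⁻¹ * ∑ c, f (S w c) ≤ f w - κ := by
      rwa [inv_mul_le_iff₀ (by positivity)]
    linarith
  have hB : ∀ t, Measurable (B (t + 1)) := fun t => hrun.measurable_batch _ (by omega)
  have hx : ∀ t ω, w (t + 1 + 1) ω = S (w (t + 1) ω) (B (t + 1) ω) := fun t ω =>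
    hrun.step (t + 1) (by omega) ω
  have hmain := mul_tsum_lintegral_le (P := P) (x := fun t => w (t + 1)) hB hrun.indep_batch
    (fun t c => hrun.uniform_batch (t + 1) (by omega) c) hrun.init hx hV
  have hsurv := lintegral_tsum_survival (P := P) (x := fun t => w (t + 1)) hB hrun.init hx A
  have hle : ∫⁻ ω, (hittingTime q σ y z γ w ω : ℝ≥0∞) ∂P ≤ ENNReal.ofReal (1 + f w₁ / κ) := by
    refine (lintegral_mono fun ω => hittingTime_le_tsum y z γ w ω).trans ?_
    rw [lintegral_add_left measurable_const, hsurv, lintegral_one, measure_univ,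
      ENNReal.ofReal_add zero_le_one (div_nonneg (hf0 _) hκ0.le), ENNReal.ofReal_one,
      ENNReal.ofReal_div_of_pos hκ0]
    gcongr
    rw [ENNReal.le_div_iff_mul_le (Or.inl (by simpa using hκ0)) (Or.inl ENNReal.ofReal_ne_top),
      mul_comm]
    exact hmain
  refine hle.trans_lt ?_
  have hnum : 0 < 4 * f w₁ + γ := by linarith [hf0 w₁]
  rcases hγ.eq_or_lt with h | h
  -- Division by zero in `ℝ≥0∞` gives `⊤` only for a nonzero numerator, which holds because `γ > 0`.
  · rw [h, sub_self, mul_zero, ENNReal.ofReal_zero, ENNReal.div_zero (by simpa using hnum)]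
    exact ENNReal.ofReal_lt_top
  · set δ := γ - 13 / (1 - α) ^ 2 * sigmaSq with hδ
    have hδ0 : 0 < δ := sub_pos.2 h
    have hδγ : δ < γ := by
      have : 0 < 13 / (1 - α) ^ 2 * sigmaSq := by positivity
      linarith
    have hden : 0 < 4 * α * (1 - α) * δ := by positivity
    rw [← ENNReal.ofReal_div_of_pos hden, ENNReal.ofReal_lt_ofReal_iff (by positivity), add_div,
      add_comm]
    -- The term `f w₁ / κ` is compared with `f w₁ / (α(1-α)δ)`, and the leading `1` is strictly
    -- below `γ / (4α(1-α)δ)` because `4α(1-α) ≤ 1` and `δ < γ`.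
    refine add_lt_add_of_le_of_lt ?_ ?_
    · have h1 : 4 * f w₁ / (4 * α * (1 - α) * δ) = f w₁ / (α * (1 - α) * δ) := by
        field_simp
      rw [h1]
      refine div_le_div_of_nonneg_left (hf0 _) (by positivity) ?_
      exact mul_le_mul_of_nonneg_left (by linarith) (by positivity)
    · rw [one_lt_div hden]
      have h2 : 4 * α * (1 - α) ≤ 1 := by nlinarith [sq_nonneg (1 - 2 * α)]
      nlinarith
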